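/- Consider a random access machine with the following restrictions. The input is a sequence $\sigma=\langle\sigma(1),\dots,\sigma(n)\rangle$ of $n$ integers (of arbitrary size, possibly with repetitions) in read-only memory; two input elements given by their positions can be compared in one time unit. The output is written to a write-only memory, to which input elements, given by their positions, can be appended. The additional readable and writable memory is divided into words of $O(\log n)$ bits, on which an arithmetic operation, a comparison, or a direct or indirect access takes one time unit; the space used is the total number of bits of this additional memory. There is an algorithm (a single program for this machine) that, given integers $n\ge 2$ and $s$ with $\sqrt n\le s\le n$ and a sequence $\sigma$ of $n$ integers, outputs a longest (strictly) increasing subsequence of $\sigma$, that is, $\sigma(i_1)<\dots<\sigma(i_\ell)$ with $1\le i_1<\dots<i_\ell\le n$ and $\ell$ as large as possible, element by element in this order, in $O\!\left(\frac1s\, n^2\log^2 n\right)$ time using $O(s\log n)$ bits of space. The constants hidden in the $O$-notation are absolute. -/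

import Mathlib

/-! ### Increasing subsequences -/

/-- The list of positions `i₁, …, i_ℓ` (counted from `0`) describes the increasing subsequence
`σ(i₁), …, σ(i_ℓ)` of `σ`: `i₁ < ⋯ < i_ℓ` and `σ(i₁) < ⋯ < σ(i_ℓ)`. -/
def IsIncreasingSubseq {n : ℕ} (σ : Fin n → ℤ) (l : List (Fin n)) : Prop :=
  l.Pairwise (· < ·) ∧ (l.map σ).Pairwise (· < ·)

/-- The increasing subsequence described by `l` is a longest one. -/
def IsLongestIncreasingSubseq {n : ℕ} (σ : Fin n → ℤ) (l : List (Fin n)) : Prop :=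
  IsIncreasingSubseq σ l ∧ ∀ l', IsIncreasingSubseq σ l' → l'.length ≤ l.length

/-! ### Random access machines with read-only input and write-only output

The input is an array of `n` integers of any size in read-only memory. It is accessed by comparing
two of its elements, which are given by their positions. The output memory is write-only: elements
of the input can be appended to it. The additional memory, which can be read and written, consists
of `M` words of `W` bits each, that is, of `M * W` bits. -/

namespace RAM

/-- Arithmetic on words. `sub` is truncated at `0`; `div` is integer division, with `x / 0 = 0`. -/
inductive Op where
  | add
  | sub
  | mul
  | div

/-- The value of an arithmetic operation. -/
def Op.eval : Op → ℕ → ℕ → ℕ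
  | .add, x, y => x + y
  | .sub, x, y => x - y
  | .mul, x, y => x * y
  | .div, x, y => x / y

/-- The tests. Below, `mem[a]` is the content of the word with address `a`. -/
inductive Test where
  /-- `mem[a] < mem[b]` -/
  | lt (a b : ℕ)
  /-- `mem[a] ≤ mem[b]` -/
  | le (a b : ℕ)
  /-- `σ(mem[a]) < σ(mem[b])` -/
  | inputLT (a b : ℕ)
  /-- `σ(mem[a]) ≤ σ(mem[b])` -/
  | inputLE (a b : ℕ)

/-- The elementary instructions. -/
inductive Instr where
  /-- `mem[a] := v` -/
  | const (a v : ℕ)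
  /-- `mem[a] := mem[b]` -/
  | copy (a b : ℕ)
  /-- `mem[a] := mem[b] o mem[c]` -/
  | arith (o : Op) (a b c : ℕ)
  /-- `mem[a] := mem[mem[b]]` -/
  | load (a b : ℕ)
  /-- `mem[mem[a]] := mem[b]` -/
  | store (a b : ℕ)
  /-- append the input element with position `mem[a]` to the output -/
  | output (a : ℕ)

/-- Programs. A program is a fixed finite text, so the control state takes no working memory
beyond a constant number of bits; there are no procedure calls. -/
inductive Program where
  | instr (I : Instr)
  | seq (p q : Program)
  | branch (b : Test) (p q : Program)
  | loop (b : Test) (p : Program)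

/-- The contents of the additional memory, and the output produced so far. Only the words with
address below `M` exist, see `State.read` and `State.write`. -/
structure State (n : ℕ) where
  mem : ℕ → ℕ
  /-- The elements of the input that were output, in this order, each given by its position. -/
  out : List (Fin n)

/-- Reading a word; a fault if there is no word with this address. -/
def State.read {n : ℕ} (M : ℕ) (S : State n) (a : ℕ) : Option ℕ :=
  if a < M then some (S.mem a) else none

/-- Writing a word; a fault if there is no word with this address, or if the value does not fit
into `W` bits. -/
def State.write {n : ℕ} (M W : ℕ) (S : State n) (a v : ℕ) : Option (State n) :=
  if a < M ∧ v < 2 ^ W then some { S with mem := Function.update S.mem a v } else none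

/-- The input position that is stored in a word; a fault if it is not one of `0, …, n - 1`. -/
def State.position {n : ℕ} (M : ℕ) (S : State n) (a : ℕ) : Option (Fin n) :=
  (S.read M a).bind fun i => if h : i < n then some ⟨i, h⟩ else none

/-- The outcome of a test, `none` being a fault. -/
def Test.eval {n : ℕ} (σ : Fin n → ℤ) (M : ℕ) (S : State n) : Test → Option Bool
  | .lt a b => (S.read M a).bind fun x => (S.read M b).bind fun y => some (decide (x < y))
  | .le a b => (S.read M a).bind fun x => (S.read M b).bind fun y => some (decide (x ≤ y))
  | .inputLT a b =>
      (S.position M a).bind fun i => (S.position M b).bind fun j => some (decide (σ i < σ j))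
  | .inputLE a b =>
      (S.position M a).bind fun i => (S.position M b).bind fun j => some (decide (σ i ≤ σ j))

/-- The effect of an instruction, `none` being a fault. -/
def Instr.exec {n : ℕ} (M W : ℕ) (S : State n) : Instr → Option (State n)
  | .const a v => S.write M W a v
  | .copy a b => (S.read M b).bind fun x => S.write M W a x
  | .arith o a b c =>
      (S.read M b).bind fun x => (S.read M c).bind fun y => S.write M W a (o.eval x y)
  | .load a b => (S.read M b).bind fun x => (S.read M x).bind fun y => S.write M W a y
  | .store a b => (S.read M a).bind fun x => (S.read M b).bind fun y => S.write M W x y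
  | .output a => (S.position M a).bind fun i => some { S with out := S.out ++ [i] }

/-- `Exec σ M W p S t S'`: on input `σ`, with `M` words of `W` bits, the program `p` started in
the state `S` terminates without a fault after exactly `t` time units in the state `S'`. Every
instruction and every evaluation of a test takes one time unit. -/
inductive Exec {n : ℕ} (σ : Fin n → ℤ) (M W : ℕ) :
    Program → State n → ℕ → State n → Prop
  | instr {I : Instr} {S S' : State n} (h : I.exec M W S = some S') :
      Exec σ M W (.instr I) S 1 S'
  | seq {p q : Program} {S S' S'' : State n} {t t' : ℕ}
      (hp : Exec σ M W p S t S') (hq : Exec σ M W q S' t' S'') :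
      Exec σ M W (.seq p q) S (t + t') S''
  | branch_true {b : Test} {p q : Program} {S S' : State n} {t : ℕ}
      (hb : b.eval σ M S = some true) (hp : Exec σ M W p S t S') :
      Exec σ M W (.branch b p q) S (t + 1) S'
  | branch_false {b : Test} {p q : Program} {S S' : State n} {t : ℕ}
      (hb : b.eval σ M S = some false) (hq : Exec σ M W q S t S') :
      Exec σ M W (.branch b p q) S (t + 1) S'
  | loop_true {b : Test} {p : Program} {S S' S'' : State n} {t t' : ℕ}
      (hb : b.eval σ M S = some true) (hp : Exec σ M W p S t S')
      (hl : Exec σ M W (.loop b p) S' t' S'') :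
      Exec σ M W (.loop b p) S (t + t' + 1) S''
  | loop_false {b : Test} {p : Program} {S : State n}
      (hb : b.eval σ M S = some false) :
      Exec σ M W (.loop b p) S 1 S

/-- The initial state: `mem[0] = n`, `mem[1] = s`, all other words are `0`, no output. -/
def initialState (n s : ℕ) : State n where
  mem a := if a = 0 then n else if a = 1 then s else 0
  out := []

/-- On the machine with `M` words of `W` bits, the program `p`, given the input `σ` of length `n`
and the parameter `s`, terminates without a fault after exactly `t` time units with output `l`. -/
def Outputs (p : Program) {n : ℕ} (σ : Fin n → ℤ) (s M W t : ℕ) (l : List (Fin n)) : Prop :=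
  2 ≤ M ∧ n < 2 ^ W ∧ s < 2 ^ W ∧
    ∃ S : State n, Exec σ M W p (initialState n s) t S ∧ S.out = l

end RAM

/-! The algorithm is patience sorting in batches, combined with divide and conquer. Positions are
shifted to `1, …, n`, and sentinels `0` (value `⊥`) and `n + 1` (value `⊤`) are added, so every
subproblem asks for a longest chain strictly between two positions `a` and `b`.

Let the rank of `j` be the number of steps of a longest chain from `a` to `j`, and let pile `k`
consist of the admissible positions of rank `k`. Within a pile the values never increase from left
to right, so the last element met so far, the top, decides by one comparison whether a new element
has rank above `k` (`IsTop.lt_iff`); binary search over the tops finds the rank. There is room for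
only about `s` piles. If pile `i` is stored explicitly, one pass over the interval builds the tops
and sizes of piles `i + 1, …, i + s`. At most `n ≤ s ^ 2` positions lie strictly between `a` and
`b`, so some pile in the upper half of this window has at most `2 * s + 1` elements
(`exists_small_count`). A second pass records it, and it becomes the next base pile. Thus `i` grows
by more than `s / 2` per batch and `O(n / s)` batches reach the maximal rank.

To split the problem, each top carries a pivot: the element whose rank is the largest power of two
not exceeding the rank of the top, on some longest chain to the top. Unlike a midpoint, it can be
maintained without knowing the final length (`pivot_self`, `Pivot.step`). At maximal rank it cuts a
longest chain of length at least `2 ^ t` into two parts shorter than `2 ^ t` (`Pivot.splits`), so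
the recursion has logarithmic depth and needs only a short stack of right endpoints. The intervals
on one level are disjoint, and an interval costs `O((b - a) * log n * n / s)`; summing over the
levels gives `O(n ^ 2 * log n ^ 2 / s)`.

The program is written in a small language with registers and arrays, whose translation to the
machine is verified once (`Run.exec`). Since the elapsed time is part of the state, the
weakest-precondition calculus proves correctness, termination and running time together. -/

/-! ### Chains, ranks and pivots -/

namespace LIS

variable {α : Type*} [LinearOrder α]

/-- Position `i` comes before `j` and carries a smaller value. -/
def Prec (v : ℕ → α) (i j : ℕ) : Prop := i < j ∧ v i < v j

theorem Prec.trans {v : ℕ → α} {i j k : ℕ} (h : Prec v i j) (h' : Prec v j k) : Prec v i k :=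
  ⟨h.1.trans h'.1, h.2.trans h'.2⟩

instance (v : ℕ → α) : IsTrans ℕ (Prec v) := ⟨fun _ _ _ => Prec.trans⟩

/-- `l` is an increasing subsequence strictly between the positions `a` and `b`. -/
def Between (v : ℕ → α) (a b : ℕ) (l : List ℕ) : Prop := List.IsChain (Prec v) (a :: (l ++ [b]))

/-- `l` is a longest increasing subsequence strictly between the positions `a` and `b`. -/
def Longest (v : ℕ → α) (a b : ℕ) (l : List ℕ) : Prop :=
  Between v a b l ∧ ∀ l', Between v a b l' → l'.length ≤ l.length

theorem between_append {v : ℕ → α} {a b m : ℕ} {l₁ l₂ : List ℕ} :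
    Between v a b (l₁ ++ m :: l₂) ↔ Between v a m l₁ ∧ Between v m b l₂ := by
  unfold Between
  have : a :: (l₁ ++ m :: l₂ ++ [b]) = (a :: l₁) ++ m :: (l₂ ++ [b]) := by simp
  rw [this, List.isChain_split]
  simp

theorem Between.prec {v : ℕ → α} {a b : ℕ} {l : List ℕ} (h : Between v a b l) : Prec v a b := by
  have h' : List.Pairwise (Prec v) (a :: (l ++ [b])) := List.isChain_iff_pairwise.1 h
  exact List.rel_of_pairwise_cons h' (by simp)

theorem between_nil {v : ℕ → α} {a b : ℕ} : Between v a b [] ↔ Prec v a b := by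
  simp [Between]

/-- Exchange argument: a longer chain on one side of `m` could be glued to the other side. -/
theorem Longest.split {v : ℕ → α} {a b m : ℕ} {l₁ l₂ : List ℕ}
    (h : Longest v a b (l₁ ++ m :: l₂)) : Longest v a m l₁ ∧ Longest v m b l₂ := by
  obtain ⟨h, hmax⟩ := h
  rw [between_append] at h
  refine ⟨⟨h.1, fun l' hl' => ?_⟩, ⟨h.2, fun l' hl' => ?_⟩⟩
  · have := hmax _ (between_append.2 ⟨hl', h.2⟩)
    simpa using this
  · have := hmax _ (between_append.2 ⟨h.1, hl'⟩)
    simpa using this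

/-- The recursion may solve its halves by other chains than those that witnessed the pivot; only the
lengths matter. -/
theorem Longest.join {v : ℕ → α} {a b m : ℕ} {l₁ l₂ l₁' l₂' : List ℕ}
    (h : Longest v a b (l₁ ++ m :: l₂)) (h₁ : Longest v a m l₁') (h₂ : Longest v m b l₂') :
    Longest v a b (l₁' ++ m :: l₂') := by
  refine ⟨between_append.2 ⟨h₁.1, h₂.1⟩, fun l' hl' => (h.2 l' hl').trans ?_⟩
  have h3 := h₁.2 _ (between_append.1 h.1).1
  have h4 := h₂.2 _ (between_append.1 h.1).2
  simp only [List.length_append, List.length_cons]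
  omega

/-! ### Ranks -/

/-- The positions that can occur in an increasing subsequence from `a` to `b`, except for `b`. -/
def Good (v : ℕ → α) (a b j : ℕ) : Prop := j = a ∨ (Prec v a j ∧ Prec v j b)

theorem Good.le {v : ℕ → α} {a b j : ℕ} (h : Good v a b j) : a ≤ j := by
  rcases h with h | h
  · omega
  · exact h.1.1.le

theorem Good.prec {v : ℕ → α} {a b j : ℕ} (hab : Prec v a b) (h : Good v a b j) : Prec v j b := by
  rcases h with h | h
  · rwa [h]
  · exact h.2

theorem Good.of_prec {v : ℕ → α} {a b i j : ℕ} (h : Good v a b i) (hij : Prec v i j)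
    (hj : Prec v j b) : Good v a b j := by
  refine Or.inr ⟨?_, hj⟩
  rcases h with h | h
  · rwa [← h]
  · exact h.1.trans hij

open Classical in
/-- The number of steps of a longest increasing subsequence from `a` to `j`. -/
noncomputable def rank (v : ℕ → α) (a b : ℕ) (j : ℕ) : ℕ :=
  (Finset.univ : Finset (Fin j)).sup fun i =>
    if Good v a b i ∧ v i < v j then rank v a b i + 1 else 0
termination_by j
decreasing_by exact i.2

theorem rank_lt {v : ℕ → α} {a b i j : ℕ} (hi : Good v a b i) (h : Prec v i j) :
    rank v a b i < rank v a b j := by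
  classical
  rw [rank.eq_1 v a b j]
  have := Finset.le_sup (s := Finset.univ) (f := fun i : Fin j =>
    if Good v a b i ∧ v i < v j then rank v a b i + 1 else 0) (Finset.mem_univ ⟨i, h.1⟩)
  simp only [hi, h.2, and_self, if_true] at this
  exact this

/-- Walking back along a longest chain lowers the rank by one at a time, so no smaller rank is
skipped; the position found is even a predecessor of `j`. -/
theorem exists_of_lt_rank {v : ℕ → α} {a b k j : ℕ} (h : k < rank v a b j) :
    ∃ i, Good v a b i ∧ Prec v i j ∧ rank v a b i = k := by
  classical
  induction j using Nat.strong_induction_on with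
  | _ j ih =>
    have h' := h
    rw [rank, Finset.lt_sup_iff] at h'
    obtain ⟨i, -, hi⟩ := h'
    split_ifs at hi with hg
    · rcases Nat.lt_succ_iff_lt_or_eq.1 hi with hlt | heq
      · obtain ⟨i', h1, h2, h3⟩ := ih i i.2 hlt
        exact ⟨i', h1, h2.trans ⟨i.2, hg.2⟩, h3⟩
      · exact ⟨i, hg.1, ⟨i.2, hg.2⟩, heq.symm⟩
    · omega

theorem rank_left {v : ℕ → α} {a b : ℕ} : rank v a b a = 0 := by
  by_contra h
  obtain ⟨i, h1, h2, -⟩ := exists_of_lt_rank (Nat.pos_of_ne_zero h)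
  exact absurd h1.le (not_le.2 h2.1)

/-- `Good` is essential: positions that no admissible position precedes also get rank `0`, as an
empty supremum. -/
theorem Good.eq_left {v : ℕ → α} {a b j : ℕ} (h : Good v a b j) (hr : rank v a b j = 0) :
    j = a := by
  rcases h with h | h
  · exact h
  · have := rank_lt (b := b) (Or.inl rfl) h.1
    omega

/-- Each step of a chain advances the position by at least one. This keeps ranks within a word and
bounds the number of batches. -/
theorem Good.rank_add_le {v : ℕ → α} {a b j : ℕ} (h : Good v a b j) : rank v a b j + a ≤ j := by
  induction j using Nat.strong_induction_on with
  | _ j ih =>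
    rcases Nat.eq_zero_or_pos (rank v a b j) with h0 | h0
    · have := h.le
      omega
    · obtain ⟨i, h1, h2, h3⟩ := exists_of_lt_rank (Nat.sub_lt h0 one_pos)
      have := ih i h2.1 h1
      have := h2.1
      omega

theorem exists_chain {v : ℕ → α} {a b j : ℕ} (h : Good v a b j) (hr : 0 < rank v a b j) :
    ∃ l : List ℕ, l.length + 1 = rank v a b j ∧ Between v a j l := by
  induction j using Nat.strong_induction_on with
  | _ j ih =>
    obtain ⟨i, h1, h2, h3⟩ := exists_of_lt_rank (Nat.sub_lt hr one_pos)
    rcases Nat.eq_zero_or_pos (rank v a b i) with h0 | h0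
    · have := h1.eq_left h0
      subst this
      exact ⟨[], by simp; omega, between_nil.2 h2⟩
    · obtain ⟨l, hl, hc⟩ := ih i h2.1 h1 h0
      exact ⟨l ++ [i], by simp; omega, between_append.2 ⟨hc, between_nil.2 h2⟩⟩

/-- The start `c` is general for the sake of the induction. With `c = a` it bounds the length of
every chain by the largest rank. -/
theorem Between.exists_rank {v : ℕ → α} {a b c : ℕ} {l : List ℕ} (hc : Good v a b c)
    (h : Between v c b l) : ∃ j, Good v a b j ∧ rank v a b c + l.length ≤ rank v a b j := by
  induction l generalizing c with
  | nil => exact ⟨c, hc, by simp⟩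
  | cons d l ih =>
    have h' : Between v c d [] ∧ Between v d b l := between_append (l₁ := []).1 h
    have hcd := between_nil.1 h'.1
    have hd : Good v a b d := hc.of_prec hcd h'.2.prec
    obtain ⟨j, hj, hle⟩ := ih hd h'.2
    have := rank_lt hc hcd
    exact ⟨j, hj, by simp only [List.length_cons]; omega⟩

/-! ### Pivots -/

/-- `m` splits a longest increasing subsequence from `a` to `j` at the largest power of two. -/
def Pivot (v : ℕ → α) (a b j m : ℕ) : Prop :=
  (j = a ∧ m = 0) ∨ ∃ (l₁ l₂ : List ℕ) (t : ℕ), l₁.length + 1 = 2 ^ t ∧ l₂.length < 2 ^ t ∧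
    l₁.length + 1 + l₂.length = rank v a b j ∧ ∀ y, Prec v j y → Between v a y (l₁ ++ m :: l₂)

/-- At a power of two the position becomes its own pivot, with nothing behind it. Quantifying over a
later endpoint `y` in `Pivot` treats this case like the one in which `j` ends the second part. -/
theorem pivot_self {v : ℕ → α} {a b j t : ℕ} (h : Good v a b j) (hr : rank v a b j = 2 ^ t) :
    Pivot v a b j j := by
  obtain ⟨l, hl, hc⟩ := exists_chain h (by rw [hr]; positivity)
  exact Or.inr ⟨l, [], t, by omega, by simp, by simpa using hl,
    fun y hy => between_append.2 ⟨hc, between_nil.2 hy⟩⟩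

/-- Otherwise the pivot of a predecessor is inherited. The second part grows by one and stays below
`2 ^ t`, since reaching `2 ^ t` would make the rank `2 ^ (t + 1)`. -/
theorem Pivot.step {v : ℕ → α} {a b i j m : ℕ} (h : Pivot v a b i m)
    (hij : Prec v i j) (hr : rank v a b i + 1 = rank v a b j)
    (hp : ∀ t, rank v a b j ≠ 2 ^ t) : Pivot v a b j m := by
  rcases h with ⟨rfl, -⟩ | ⟨l₁, l₂, t, h1, h2, h3, h4⟩
  · rw [rank_left] at hr
    exact absurd hr.symm (by simpa using hp 0)
  · refine Or.inr ⟨l₁, l₂ ++ [j], t, h1, ?_, by simp; omega, fun y hy => ?_⟩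
    · have := hp (t + 1)
      rw [pow_succ] at this
      simp only [List.length_append, List.length_cons, List.length_nil]
      omega
    · have := between_append (l₁ := l₁ ++ m :: l₂).2 ⟨h4 j hij, between_nil.2 hy⟩
      simpa using this

theorem Pivot.lt {v : ℕ → α} {a b j m : ℕ} (hab : Prec v a b) (h : Pivot v a b j m)
    (hj : Good v a b j) : m < b := by
  rcases h with ⟨-, rfl⟩ | ⟨l₁, l₂, t, -, -, -, h4⟩
  · exact Nat.pos_of_ne_zero (by have := hab.1; omega)
  · exact (between_append.1 (h4 b (hj.prec hab))).2.prec.1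

/-- The pivot of an element of maximal rank: it is `0` if there is nothing between `a` and `b`,
and otherwise it splits a longest increasing subsequence between `a` and `b`. -/
def Splits (v : ℕ → α) (a b m : ℕ) : Prop :=
  (m = 0 ∧ Longest v a b []) ∨ (m ≠ 0 ∧ ∃ (l₁ l₂ : List ℕ) (t : ℕ), l₁.length < 2 ^ t ∧
    l₂.length < 2 ^ t ∧ 2 ^ t ≤ (l₁ ++ m :: l₂).length ∧ Longest v a b (l₁ ++ m :: l₂))

/-- The largest rank is the length of a longest chain between `a` and `b`. The value `0` can flag
the empty case because a true pivot lies to the right of `a`. -/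
theorem Pivot.splits {v : ℕ → α} {a b j m : ℕ} (hab : Prec v a b) (hj : Good v a b j)
    (h : Pivot v a b j m) (hmax : ∀ i, Good v a b i → rank v a b i ≤ rank v a b j) :
    Splits v a b m := by
  have key : ∀ l, Between v a b l → l.length ≤ rank v a b j := fun l hl => by
    obtain ⟨i, hi, hle⟩ := hl.exists_rank (Or.inl rfl)
    have := hmax i hi
    omega
  rcases h with ⟨rfl, rfl⟩ | ⟨l₁, l₂, t, h1, h2, h3, h4⟩
  · rw [rank_left] at key
    exact Or.inl ⟨rfl, between_nil.2 hab, key⟩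
  · have hb := h4 b (hj.prec hab)
    refine Or.inr ⟨?_, l₁, l₂, t, by omega, h2, by simp; omega, hb, fun l' hl' => ?_⟩
    · have := (between_append.1 hb).1.prec.1
      omega
    · have := key l' hl'
      simp only [List.length_append, List.length_cons]
      omega

/-! ### Piles and their sizes -/

/-- Among the positions before `j`, position `x` is the last one of rank `k`. -/
def IsTop (v : ℕ → α) (a b j k x : ℕ) : Prop :=
  Good v a b x ∧ x < j ∧ rank v a b x = k ∧
    ∀ y, Good v a b y → y < j → rank v a b y = k → y ≤ x

/-- Values in one pile are non-increasing, since a later larger element would have larger rank.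
Hence the last element of the pile is its smallest, and if any element of rank `k` is smaller than
`v j`, then so is the top. -/
theorem IsTop.lt_iff {v : ℕ → α} {a b j k x : ℕ} (h : IsTop v a b j k x) :
    v x < v j ↔ k < rank v a b j := by
  obtain ⟨h1, h2, h3, h4⟩ := h
  constructor
  · intro hlt
    rw [← h3]
    exact rank_lt h1 ⟨h2, hlt⟩
  · intro hlt
    obtain ⟨i, g1, g2, g3⟩ := exists_of_lt_rank hlt
    have hix := h4 i g1 g2.1 g3
    refine lt_of_le_of_lt ?_ g2.2
    by_contra hcon
    rcases hix.eq_or_lt with rfl | hix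
    · exact hcon le_rfl
    · have := rank_lt g1 ⟨hix, not_le.1 hcon⟩
      omega

theorem IsTop.succ {v : ℕ → α} {a b j k x : ℕ} (h : IsTop v a b j k x)
    (hj : Good v a b j → rank v a b j ≠ k) : IsTop v a b (j + 1) k x := by
  obtain ⟨h1, h2, h3, h4⟩ := h
  refine ⟨h1, by omega, h3, fun y hy hlt hr => ?_⟩
  rcases Nat.lt_succ_iff_lt_or_eq.1 hlt with h | rfl
  · exact h4 y hy h hr
  · exact absurd hr (hj hy)

theorem isTop_succ_self {v : ℕ → α} {a b j : ℕ} (hj : Good v a b j) :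
    IsTop v a b (j + 1) (rank v a b j) j :=
  ⟨hj, by omega, rfl, fun y _ hlt _ => by omega⟩

open Classical in
/-- The number of positions before `j` that have rank `k`. -/
noncomputable def count (v : ℕ → α) (a b k j : ℕ) : ℕ :=
  ((Finset.range j).filter fun x => Good v a b x ∧ rank v a b x = k).card

theorem count_succ_of {v : ℕ → α} {a b k j : ℕ} (hj : Good v a b j) (hr : rank v a b j = k) :
    count v a b k (j + 1) = count v a b k j + 1 := by
  classical
  unfold count
  rw [Finset.range_add_one, Finset.filter_insert, if_pos ⟨hj, hr⟩, Finset.card_insert_of_notMem]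
  simp

theorem count_succ_of_not {v : ℕ → α} {a b k j : ℕ} (h : Good v a b j → rank v a b j ≠ k) :
    count v a b k (j + 1) = count v a b k j := by
  classical
  unfold count
  rw [Finset.range_add_one, Finset.filter_insert, if_neg (fun h' => h h'.1 h'.2)]

theorem count_mono {v : ℕ → α} {a b k i j : ℕ} (h : i ≤ j) : count v a b k i ≤ count v a b k j := by
  classical
  exact Finset.card_le_card (Finset.filter_subset_filter _ (Finset.range_subset_range.2 h))

theorem count_left {v : ℕ → α} {a b k : ℕ} : count v a b k a = 0 := by
  classical
  unfold count
  rw [Finset.card_eq_zero, Finset.filter_eq_empty_iff]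
  intro x hx h
  have := h.1.le
  simp at hx
  omega

theorem count_pos_iff {v : ℕ → α} {a b k j : ℕ} :
    0 < count v a b k j ↔ ∃ x < j, Good v a b x ∧ rank v a b x = k := by
  classical
  unfold count
  rw [Finset.card_pos]
  simp [Finset.Nonempty]

/-- The number of earlier elements of its pile serves as the index of an element in the recorded
array; this makes the indices distinct and in range. -/
theorem count_lt {v : ℕ → α} {a b k i j : ℕ} (hi : Good v a b i) (hr : rank v a b i = k)
    (h : i < j) : count v a b k i < count v a b k j := by
  have := count_succ_of hi hr
  have := count_mono (v := v) (a := a) (b := b) (k := k) (Nat.succ_le_of_lt h)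
  simp only [Nat.succ_eq_add_one] at this
  omega

/-- After position `j`, either there is a next position of rank `k`, or there is none before
the end. -/
theorem exists_next {v : ℕ → α} {a b k j : ℕ} (hab : Prec v a b) (hj : j ≤ b) :
    (∃ x, j ≤ x ∧ x < b ∧ Good v a b x ∧ rank v a b x = k ∧ count v a b k x = count v a b k j) ∨
      count v a b k b = count v a b k j := by
  induction hd : b - j generalizing j with
  | zero =>
    obtain rfl : j = b := by omega
    exact Or.inr rfl
  | succ d ih =>
    by_cases h : Good v a b j ∧ rank v a b j = k
    · exact Or.inl ⟨j, le_rfl, by omega, h.1, h.2, rfl⟩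
    · have hc := count_succ_of_not (v := v) (a := a) (b := b) (k := k) (j := j)
        (fun h1 h2 => h ⟨h1, h2⟩)
      rcases ih (j := j + 1) (by omega) (by omega) with ⟨x, h1, h2, h3, h4, h5⟩ | h1
      · exact Or.inl ⟨x, by omega, h2, h3, h4, by omega⟩
      · exact Or.inr (by omega)

/-- Piles of different ranks are disjoint sets of positions in `[a, j)`. -/
theorem sum_count_le {v : ℕ → α} {a b j : ℕ} (K : Finset ℕ) :
    ∑ k ∈ K, count v a b k j ≤ j - a := by
  classical
  unfold count
  rw [← Finset.card_biUnion]
  · calc _ ≤ (Finset.Ico a j).card := by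
          apply Finset.card_le_card
          intro x hx
          simp only [Finset.mem_biUnion, Finset.mem_filter, Finset.mem_range] at hx
          obtain ⟨k, -, h1, h2, -⟩ := hx
          simp [h1, h2.le]
      _ = _ := by simp
  · intro x _ y _ hxy
    rw [Function.onFun, Finset.disjoint_left]
    intro z hz hz'
    simp only [Finset.mem_filter] at hz hz'
    exact hxy (hz.2.2.symm.trans hz'.2.2)

theorem count_le {v : ℕ → α} {a b k j : ℕ} : count v a b k j ≤ j - a := by
  simpa using sum_count_le (v := v) (a := a) (b := b) (j := j) {k}

/-- Among `s` consecutive ranks there is one in the upper half that occurs at most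
`2 * s + 1` times. -/
theorem exists_small_count {v : ℕ → α} {a b i s : ℕ} (hs : 1 < s) (h : b ≤ s * s + a + 1) :
    ∃ r, s < 2 * r ∧ r ≤ s ∧ count v a b (i + r) b ≤ 2 * s + 1 := by
  by_contra! hcon
  have h1 : (s - s / 2) * (2 * s + 2) ≤ ∑ k ∈ Finset.Ioc (s / 2) s, count v a b (i + k) b := by
    have := Finset.card_nsmul_le_sum (Finset.Ioc (s / 2) s) (fun k => count v a b (i + k) b)
      (2 * s + 2) (fun k hk => by
        simp only [Finset.mem_Ioc] at hk
        exact hcon k (by omega) hk.2)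
    simpa using this
  have h2 : ∑ k ∈ Finset.Ioc (s / 2) s, count v a b (i + k) b ≤ b - a := by
    have := sum_count_le (v := v) (a := a) (b := b) (j := b)
      ((Finset.Ioc (s / 2) s).map (addLeftEmbedding i))
    rwa [Finset.sum_map] at this
  have h3 : s ≤ 2 * (s - s / 2) := by omega
  -- If all piles in the upper half were larger, they would contain at least `s / 2 * (2 * s + 2) =
  -- s * s + s` positions. This exceeds the `s * s + 1` available ones because `1 < s`.
  have h4 : s * s + 1 < (s - s / 2) * (2 * s + 2) := by nlinarith
  omega

end LIS

/-! ### A small language with named registers and arrays -/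

set_option linter.constructorNameAsVariable false

namespace RAM

/-- The registers. Register `n` holds the length of the input and `s` the parameter. -/
inductive Reg where
  | n | s | a | b | sp | i | r | q | m | j | p | lo | hi | mid | x | y | z | go | res
  deriving DecidableEq

/-- The address of a register. -/
def Reg.idx : Reg → ℕ
  | n => 0 | s => 1 | a => 2 | b => 3 | sp => 4 | i => 5 | r => 6 | q => 7 | m => 8 | j => 9
  | p => 10 | lo => 11 | hi => 12 | mid => 13 | x => 14 | y => 15 | z => 16 | go => 17 | res => 18

/-- Memory layout: registers lie below `28`, addresses `28` to `30` are scratch, `31` holds `0`, and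
element `i` of array `f` lies at `32 + 8 * i + f.idx`. -/
theorem Reg.idx_lt (x : Reg) : x.idx < 28 := by cases x <;> decide

theorem Reg.idx_injective : Function.Injective Reg.idx := by
  intro x y h
  cases x <;> cases y <;> first | rfl | (exact absurd h (by decide))

/-- The arrays. -/
inductive Arr where
  | top | anc | cnt | base | baseAnc | buf | bufAnc | stack
  deriving DecidableEq

/-- The offset of an array; the arrays are interleaved. -/
def Arr.idx : Arr → ℕ
  | top => 0 | anc => 1 | cnt => 2 | base => 3 | baseAnc => 4 | buf => 5 | bufAnc => 6 | stack => 7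

theorem Arr.idx_lt (f : Arr) : f.idx < 8 := by cases f <;> decide

theorem Arr.idx_injective : Function.Injective Arr.idx := by
  intro x y h
  cases x <;> cases y <;> first | rfl | (exact absurd h (by decide))

/-- Conditions. -/
inductive Cond where
  | lt (x y : Reg)
  | le (x y : Reg)
  | pos (x : Reg)

/-- Commands. In `cmp` and `output`, positions are counted from `1`, and `0` and `n + 1` are
sentinels. -/
inductive Cmd where
  | skip
  | const (x : Reg) (v : ℕ)
  | copy (x y : Reg)
  | arith (o : Op) (x y z : Reg)
  | arithConst (o : Op) (x y : Reg) (c : ℕ)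
  | load (x : Reg) (f : Arr) (y : Reg)
  | store (f : Arr) (y x : Reg)
  | cmp (z x y : Reg)
  | output (x : Reg)
  | seq (c d : Cmd)
  | branch (b : Cond) (c d : Cmd)
  | loop (b : Cond) (c : Cmd)

/-- A sequence of commands. -/
def Cmd.block : List Cmd → Cmd
  | [] => .skip
  | [c] => c
  | c :: d :: l => .seq c (block (d :: l))

/-- Translation of a condition into a test. Address `31` always holds `0`. -/
def Cond.compile : Cond → Test
  | .lt x y => .lt x.idx y.idx
  | .le x y => .le x.idx y.idx
  | .pos x => .lt 31 x.idx

/-- Computing the address of an array element, into address `28`. -/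
def addressProgram (f : Arr) (y : Reg) : Program :=
  .seq (.instr (.const 28 8)) (.seq (.instr (.arith .mul 28 y.idx 28))
    (.seq (.instr (.const 29 (32 + f.idx))) (.instr (.arith .add 28 28 29))))

/-- Translation of commands into programs. -/
def Cmd.compile : Cmd → Program
  | .skip => .instr (.copy 30 31)
  | .const x v => .instr (.const x.idx v)
  | .copy x y => .instr (.copy x.idx y.idx)
  | .arith o x y z => .instr (.arith o x.idx y.idx z.idx)
  | .arithConst o x y c => .seq (.instr (.const 28 c)) (.instr (.arith o x.idx y.idx 28))
  | .load x f y => .seq (addressProgram f y) (.instr (.load x.idx 28))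
  | .store f y x => .seq (addressProgram f y) (.instr (.store 28 x.idx))
  | .cmp z x y =>
      .seq (.instr (.const 28 1)) (.seq (.instr (.arith .sub 29 x.idx 28))
        (.seq (.instr (.arith .sub 30 y.idx 28))
          (.branch (.lt 31 x.idx)
            (.branch (.le y.idx Reg.n.idx)
              (.branch (.inputLT 29 30) (.instr (.const z.idx 1)) (.instr (.const z.idx 0)))
              (.instr (.const z.idx 1)))
            (.instr (.const z.idx 1)))))
  | .output x => .seq (.instr (.const 28 1)) (.seq (.instr (.arith .sub 28 x.idx 28))
      (.instr (.output 28)))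
  | .seq c d => .seq c.compile d.compile
  | .branch b c d => .branch b.compile c.compile d.compile
  | .loop b c => .loop b.compile c.compile

/-- The input as a sequence with sentinels `⊥` at position `0` and `⊤` behind position `n`. -/
def val {n : ℕ} (σ : Fin n → ℤ) (k : ℕ) : WithBot (WithTop ℤ) :=
  if k = 0 then ⊥ else if h : k - 1 < n then ((σ ⟨k - 1, h⟩ : WithTop ℤ) : WithBot (WithTop ℤ))
  else ((⊤ : WithTop ℤ) : WithBot (WithTop ℤ))

/-- Registers, arrays, output and elapsed time. -/
structure Env (n : ℕ) where
  reg : Reg → ℕ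
  arr : Arr → ℕ → ℕ
  out : List (Fin n)
  time : ℕ

variable {n : ℕ}

/-- Assignment to a register. -/
def Env.set (E : Env n) (x : Reg) (v t : ℕ) : Env n :=
  { E with reg := Function.update E.reg x v, time := E.time + t }

/-- Assignment to an array element. -/
def Env.put (E : Env n) (f : Arr) (i v t : ℕ) : Env n :=
  { E with arr := Function.update E.arr f (Function.update (E.arr f) i v), time := E.time + t }

/-- Passing of time. -/
def Env.tick (E : Env n) : Env n := { E with time := E.time + 1 }

section simp_lemmas

variable (E : Env n) (x y : Reg) (f g : Arr) (v t i : ℕ)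

@[simp] theorem Env.reg_set : (E.set x v t).reg y = if y = x then v else E.reg y := by
  simp [Env.set, Function.update_apply]
@[simp] theorem Env.arr_set : (E.set x v t).arr = E.arr := rfl
@[simp] theorem Env.out_set : (E.set x v t).out = E.out := rfl
@[simp] theorem Env.time_set : (E.set x v t).time = E.time + t := rfl
@[simp] theorem Env.reg_put : (E.put f i v t).reg = E.reg := rfl
@[simp] theorem Env.arr_put :
    (E.put f i v t).arr g = if g = f then Function.update (E.arr f) i v else E.arr g := by
  simp [Env.put, Function.update_apply]
@[simp] theorem Env.out_put : (E.put f i v t).out = E.out := rfl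
@[simp] theorem Env.time_put : (E.put f i v t).time = E.time + t := rfl
@[simp] theorem Env.reg_tick : E.tick.reg = E.reg := rfl
@[simp] theorem Env.arr_tick : E.tick.arr = E.arr := rfl
@[simp] theorem Env.out_tick : E.tick.out = E.out := rfl
@[simp] theorem Env.time_tick : E.tick.time = E.time + 1 := rfl

end simp_lemmas

/-- Validity of a condition. -/
def Cond.holds (E : Env n) : Cond → Prop
  | .lt x y => E.reg x < E.reg y
  | .le x y => E.reg x ≤ E.reg y
  | .pos x => 0 < E.reg x

@[simp] theorem Cond.holds_lt (E : Env n) (x y : Reg) :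
    (Cond.lt x y).holds E ↔ E.reg x < E.reg y := Iff.rfl
@[simp] theorem Cond.holds_le (E : Env n) (x y : Reg) :
    (Cond.le x y).holds E ↔ E.reg x ≤ E.reg y := Iff.rfl
@[simp] theorem Cond.holds_pos (E : Env n) (x : Reg) :
    (Cond.pos x).holds E ↔ 0 < E.reg x := Iff.rfl

/-- `Run σ N W c E E'`: with arrays of length `N` and words of `W` bits, the command `c` leads from
`E` to `E'`. -/
inductive Run (σ : Fin n → ℤ) (N W : ℕ) : Cmd → Env n → Env n → Prop
  | skip {E} : Run σ N W .skip E E.tick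
  | const {x v E} (h : v < 2 ^ W) : Run σ N W (.const x v) E (E.set x v 1)
  | copy {x y E} : Run σ N W (.copy x y) E (E.set x (E.reg y) 1)
  | arith {o x y z E} (h : o.eval (E.reg y) (E.reg z) < 2 ^ W) :
      Run σ N W (.arith o x y z) E (E.set x (o.eval (E.reg y) (E.reg z)) 1)
  | arithConst {o x y c E} (hc : c < 2 ^ W) (h : o.eval (E.reg y) c < 2 ^ W) :
      Run σ N W (.arithConst o x y c) E (E.set x (o.eval (E.reg y) c) 2)
  | load {x f y E} (h : E.reg y < N) :
      Run σ N W (.load x f y) E (E.set x (E.arr f (E.reg y)) 5)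
  | store {f y x E} (h : E.reg y < N) :
      Run σ N W (.store f y x) E (E.put f (E.reg y) (E.reg x) 5)
  | cmp {z x y E} (hn : E.reg .n = n) (hx : E.reg x ≤ n) (hy : 0 < E.reg y)
      (hy' : E.reg y ≤ n + 1) : Run σ N W (.cmp z x y) E
        (E.set z (if val σ (E.reg x) < val σ (E.reg y) then 1 else 0) 7)
  | output {x E} (h : E.reg x - 1 < n) : Run σ N W (.output x) E
      { E with out := E.out ++ [⟨E.reg x - 1, h⟩], time := E.time + 3 }
  | seq {c d E E' E''} (h : Run σ N W c E E') (h' : Run σ N W d E' E'') :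
      Run σ N W (.seq c d) E E''
  | branch_true {b c d E E'} (hb : b.holds E) (h : Run σ N W c E.tick E') :
      Run σ N W (.branch b c d) E E'
  | branch_false {b c d E E'} (hb : ¬ b.holds E) (h : Run σ N W d E.tick E') :
      Run σ N W (.branch b c d) E E'
  | loop_true {b c E E' E''} (hb : b.holds E) (h : Run σ N W c E.tick E')
      (h' : Run σ N W (.loop b c) E' E'') : Run σ N W (.loop b c) E E''
  | loop_false {b c E} (hb : ¬ b.holds E) : Run σ N W (.loop b c) E E.tick

/-! ### Correctness of the translation -/

/-- The machine state `S` represents `E`. -/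
structure Represents (N W : ℕ) (S : State n) (E : Env n) : Prop where
  lt : ∀ a, S.mem a < 2 ^ W
  zero : S.mem 31 = 0
  reg : ∀ x : Reg, S.mem x.idx = E.reg x
  arr : ∀ (f : Arr) i, i < N → S.mem (32 + 8 * i + f.idx) = E.arr f i
  out : S.out = E.out

variable {σ : Fin n → ℤ} {N W : ℕ} {S : State n} {E : Env n}

theorem State.read_of_lt {M a : ℕ} (S : State n) (h : a < M) : S.read M a = some (S.mem a) :=
  if_pos h

theorem State.write_of_lt {M W a v : ℕ} (S : State n) (h : a < M) (h' : v < 2 ^ W) :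
    S.write M W a v = some { S with mem := Function.update S.mem a v } :=
  if_pos ⟨h, h'⟩

/-- Writing to one of the scratch addresses. -/
theorem Represents.scratch (h : Represents N W S E) {a v : ℕ} (ha : 28 ≤ a) (ha' : a < 31)
    (hv : v < 2 ^ W) : Represents N W { S with mem := Function.update S.mem a v } E where
  lt b := by
    simp only [Function.update_apply]
    split_ifs
    exacts [hv, h.lt b]
  zero := by
    simp only [Function.update_apply]
    rw [if_neg (by omega), h.zero]
  reg x := by
    have := x.idx_lt
    simp only [Function.update_apply]
    rw [if_neg (by omega), h.reg]
  arr f i hi := by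
    simp only [Function.update_apply]
    rw [if_neg (by omega), h.arr f i hi]
  out := h.out

theorem Represents.set (h : Represents N W S E) {x : Reg} {v t : ℕ} (hv : v < 2 ^ W) :
    Represents N W { S with mem := Function.update S.mem x.idx v } (E.set x v t) where
  lt b := by
    simp only [Function.update_apply]
    split_ifs
    exacts [hv, h.lt b]
  zero := by
    have := x.idx_lt
    simp only [Function.update_apply]
    rw [if_neg (by omega), h.zero]
  reg y := by
    simp only [Function.update_apply, Env.reg_set, Reg.idx_injective.eq_iff, h.reg]
  arr f i hi := by
    have := x.idx_lt
    simp only [Function.update_apply]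
    rw [if_neg (by omega), h.arr f i hi, Env.arr_set]
  out := h.out

theorem Represents.put (h : Represents N W S E) {f : Arr} {i v t : ℕ} (hv : v < 2 ^ W) :
    Represents N W { S with mem := Function.update S.mem (32 + 8 * i + f.idx) v }
      (E.put f i v t) where
  lt b := by
    simp only [Function.update_apply]
    split_ifs
    exacts [hv, h.lt b]
  zero := by
    simp only [Function.update_apply]
    rw [if_neg (by omega), h.zero]
  reg y := by
    have := y.idx_lt
    simp only [Function.update_apply]
    rw [if_neg (by omega), h.reg, Env.reg_put]
  arr g k hk := by
    have h1 := f.idx_lt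
    have h2 := g.idx_lt
    simp only [Function.update_apply, Env.arr_put, h.arr g k hk]
    by_cases hgf : g = f
    · subst hgf
      simp [Function.update_apply]
    · rw [if_neg, if_neg hgf]
      intro heq
      exact hgf (Arr.idx_injective (by omega))
  out := h.out

theorem Represents.tick (h : Represents N W S E) : Represents N W S E.tick :=
  ⟨h.lt, h.zero, h.reg, h.arr, h.out⟩

theorem Represents.test (h : Represents N W S E) (b : Cond) :
    (b.holds E → b.compile.eval σ (32 + 8 * N) S = some true) ∧
      (¬ b.holds E → b.compile.eval σ (32 + 8 * N) S = some false) := by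
  have hl : ∀ x : Reg, x.idx < 32 + 8 * N := fun x => by have := x.idx_lt; omega
  have hz : 31 < 32 + 8 * N := by omega
  cases b <;>
    simp [Cond.compile, Test.eval, State.read_of_lt, hl, hz, h.reg, h.zero]

theorem exec_const {M a v : ℕ} (ha : a < M) (hv : v < 2 ^ W) :
    Exec σ M W (.instr (.const a v)) S 1 { S with mem := Function.update S.mem a v } :=
  .instr (S.write_of_lt ha hv)

theorem exec_copy {M a b : ℕ} (ha : a < M) (hb : b < M) (hv : S.mem b < 2 ^ W) :
    Exec σ M W (.instr (.copy a b)) S 1 { S with mem := Function.update S.mem a (S.mem b) } :=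
  .instr (by simp [Instr.exec, State.read_of_lt, hb, State.write_of_lt, ha, hv])

theorem exec_arith {M a b c v : ℕ} {o : Op} (ha : a < M) (hb : b < M) (hc : c < M)
    (h : o.eval (S.mem b) (S.mem c) = v) (hv : v < 2 ^ W) :
    Exec σ M W (.instr (.arith o a b c)) S 1 { S with mem := Function.update S.mem a v } :=
  .instr (by simp [Instr.exec, State.read_of_lt, hb, hc, State.write_of_lt, ha, h, hv])

theorem exec_address (h : Represents N W S E) (hW : 32 + 8 * N < 2 ^ W) (f : Arr) {y : Reg}
    (hy : E.reg y < N) : ∃ S', Exec σ (32 + 8 * N) W (addressProgram f y) S 4 S' ∧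
      Represents N W S' E ∧ S'.mem 28 = 32 + 8 * E.reg y + f.idx := by
  have hf := f.idx_lt
  have hyl := y.idx_lt
  have h1 := h.scratch (a := 28) (v := 8) (by omega) (by omega) (by omega)
  have h2 := h1.scratch (a := 28) (v := 8 * E.reg y) (by omega) (by omega) (by omega)
  have h3 := h2.scratch (a := 29) (v := 32 + f.idx) (by omega) (by omega) (by omega)
  have h4 := h3.scratch (a := 28) (v := 32 + 8 * E.reg y + f.idx) (by omega) (by omega) (by omega)
  refine ⟨_, .seq (exec_const (by omega) (by omega)) (.seq (exec_arith (v := 8 * E.reg y)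
    (by omega) (by omega) (by omega) ?_ (by omega)) (.seq (exec_const (by omega) (by omega))
    (exec_arith (v := 32 + 8 * E.reg y + f.idx) (by omega) (by omega) (by omega) ?_ (by omega)))),
    h4, by simp⟩
  · rw [h1.reg]
    simp [Op.eval, mul_comm]
  · simp [Op.eval]
    omega

theorem val_lt_iff {x y : ℕ} (hx : x ≤ n) (hx0 : 0 < x) (hy : 0 < y) (hyn : y ≤ n) :
    val σ x < val σ y ↔ σ ⟨x - 1, by omega⟩ < σ ⟨y - 1, by omega⟩ := by
  unfold val
  rw [if_neg (by omega), if_neg (by omega), dif_pos (by omega), dif_pos (by omega),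
    WithBot.coe_lt_coe, WithTop.coe_lt_coe]

theorem val_zero_lt {y : ℕ} (hy : 0 < y) : val σ 0 < val σ y := by
  unfold val
  rw [if_pos rfl, if_neg (by omega)]
  split_ifs <;> exact WithBot.bot_lt_coe _

theorem val_lt_last {x y : ℕ} (hx : x ≤ n) (hy : n < y) : val σ x < val σ y := by
  rcases Nat.eq_zero_or_pos x with rfl | h
  · exact val_zero_lt (by omega)
  · unfold val
    rw [if_neg (by omega), if_neg (by omega), dif_pos (by omega), dif_neg (by omega),
      WithBot.coe_lt_coe]
    exact WithTop.coe_lt_top _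

/-- A left sentinel `0` or a right sentinel `n + 1` is recognised before the input is accessed, and
the answer is then `1`. The bound `7` is the cost of the longest path, which does compare input
elements. -/
theorem exec_cmp (h : Represents N W S E) (hW : 32 + 8 * N < 2 ^ W) {x y z : Reg}
    (hn : E.reg .n = n) (hx : E.reg x ≤ n) (hy : 0 < E.reg y) (hy' : E.reg y ≤ n + 1) :
    ∃ t S' v, t ≤ 7 ∧ v = (if val σ (E.reg x) < val σ (E.reg y) then 1 else 0) ∧
      Exec σ (32 + 8 * N) W (Cmd.cmp z x y).compile S t S' ∧ Represents N W S' (E.set z v 7) := by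
  have hxl := x.idx_lt
  have hyl := y.idx_lt
  have hzl := z.idx_lt
  have hnl := Reg.n.idx_lt
  have hxW := h.reg x ▸ h.lt x.idx
  have hyW := h.reg y ▸ h.lt y.idx
  have hone : 1 < 2 ^ W := by omega
  obtain ⟨S₃, h3, h29, h30, key⟩ : ∃ S₃ : State n, Represents N W S₃ E ∧
      S₃.mem 29 = E.reg x - 1 ∧ S₃.mem 30 = E.reg y - 1 ∧
      ∀ (p : Program) t S', Exec σ (32 + 8 * N) W p S₃ t S' → Exec σ (32 + 8 * N) W
        (.seq (.instr (.const 28 1)) (.seq (.instr (.arith .sub 29 x.idx 28))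
          (.seq (.instr (.arith .sub 30 y.idx 28)) p))) S (1 + (1 + (1 + t))) S' := by
    have h1 := h.scratch (a := 28) (v := 1) (by omega) (by omega) hone
    have h2 := h1.scratch (a := 29) (v := E.reg x - 1) (by omega) (by omega) (by omega)
    have h3 := h2.scratch (a := 30) (v := E.reg y - 1) (by omega) (by omega) (by omega)
    exact ⟨_, h3, by simp, by simp, fun p t S' hp => .seq (exec_const (by omega) (by omega))
      (.seq (exec_arith (v := E.reg x - 1) (by omega) (by omega) (by omega)
        (by rw [h1.reg]; simp [Op.eval]) (by omega))
      (.seq (exec_arith (v := E.reg y - 1) (by omega) (by omega) (by omega)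
        (by rw [h2.reg]; simp [Op.eval]) (by omega)) hp))⟩
  have hr : ∀ k < 32, S₃.read (32 + 8 * N) k = some (S₃.mem k) := fun k hk =>
    State.read_of_lt _ (by omega)
  have hrr : ∀ x : Reg, S₃.read (32 + 8 * N) x.idx = some (E.reg x) := fun x => by
    rw [hr _ (x.idx_lt.trans (by omega)), h3.reg]
  have hb1 : Test.eval σ (32 + 8 * N) S₃ (.lt 31 x.idx) = some (decide (0 < E.reg x)) := by
    simp [Test.eval, hr, hrr, h3.zero]
  have hb2 : Test.eval σ (32 + 8 * N) S₃ (.le y.idx Reg.n.idx) =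
      some (decide (E.reg y ≤ n)) := by
    simp [Test.eval, hrr, hn]
  rcases Nat.eq_zero_or_pos (E.reg x) with hx0 | hx0
  · rw [decide_eq_false (by omega)] at hb1
    exact ⟨1 + (1 + (1 + (1 + 1))), _, 1, by omega, by rw [hx0, if_pos (val_zero_lt hy)],
      key _ _ _ (.branch_false hb1 (exec_const (by omega) hone)), h3.set hone⟩
  rw [decide_eq_true hx0] at hb1
  by_cases hyn : E.reg y ≤ n
  · rw [decide_eq_true hyn] at hb2
    have hb3 : Test.eval σ (32 + 8 * N) S₃ (.inputLT 29 30) =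
        some (decide (val σ (E.reg x) < val σ (E.reg y))) := by
      simp [Test.eval, State.position, hr, h29, h30, val_lt_iff hx hx0 hy hyn,
        show E.reg x - 1 < n by omega, show E.reg y - 1 < n by omega]
    by_cases hlt : val σ (E.reg x) < val σ (E.reg y)
    · rw [decide_eq_true hlt] at hb3
      exact ⟨1 + (1 + (1 + (1 + 1 + 1 + 1))), _, 1, by omega, by rw [if_pos hlt],
        key _ _ _ (.branch_true hb1 (.branch_true hb2 (.branch_true hb3
          (exec_const (by omega) hone)))), h3.set hone⟩
    · rw [decide_eq_false hlt] at hb3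
      exact ⟨1 + (1 + (1 + (1 + 1 + 1 + 1))), _, 0, by omega, by rw [if_neg hlt],
        key _ _ _ (.branch_true hb1 (.branch_true hb2 (.branch_false hb3
          (exec_const (by omega) (by omega))))), h3.set (by omega)⟩
  · rw [decide_eq_false hyn] at hb2
    exact ⟨1 + (1 + (1 + (1 + 1 + 1))), _, 1, by omega,
      by rw [if_pos (val_lt_last hx (by omega))],
      key _ _ _ (.branch_true hb1 (.branch_false hb2 (exec_const (by omega) hone))), h3.set hone⟩

/-- Simulation by induction on the run. The time bound is an inequality because `cmp` is always
charged for its longest path. -/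
theorem Run.exec {c : Cmd} {E E' : Env n} (hW : 32 + 8 * N < 2 ^ W) (h : Run σ N W c E E') :
    ∀ {S : State n}, Represents N W S E → ∃ t S', Exec σ (32 + 8 * N) W c.compile S t S' ∧
      Represents N W S' E' ∧ E.time + t ≤ E'.time := by
  have hl : ∀ x : Reg, x.idx < 32 + 8 * N := fun x => by have := x.idx_lt; omega
  induction h with
  | skip =>
    intro S hS
    have hv := hS.lt 31
    exact ⟨_, _, exec_copy (by omega) (by omega) hv,
      (hS.scratch (by omega) (by omega) hv).tick, le_rfl⟩
  | const h =>
    intro S hS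
    exact ⟨_, _, exec_const (hl _) h, hS.set h, le_rfl⟩
  | @copy x y E =>
    intro S hS
    have hv := hS.lt y.idx
    refine ⟨_, _, exec_copy (hl _) (hl _) hv, ?_, le_rfl⟩
    rw [hS.reg] at hv ⊢
    exact hS.set hv
  | arith h =>
    intro S hS
    exact ⟨_, _, exec_arith (hl _) (hl _) (hl _) (by rw [hS.reg, hS.reg]) h, hS.set h, le_rfl⟩
  | arithConst hc h =>
    intro S hS
    have h1 := hS.scratch (a := 28) (by omega) (by omega) hc
    exact ⟨_, _, .seq (exec_const (by omega) hc) (exec_arith (hl _) (hl _) (by omega)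
      (by rw [h1.reg]; simp) h), h1.set h, le_rfl⟩
  | @load x f y E h =>
    intro S hS
    obtain ⟨S', h1, h2, h3⟩ := exec_address (σ := σ) hS hW f h
    have hf := f.idx_lt
    have hv := h2.arr f _ h ▸ h2.lt (32 + 8 * E.reg y + f.idx)
    refine ⟨_, _, .seq h1 (.instr
      (S' := { S' with mem := Function.update S'.mem x.idx (E.arr f (E.reg y)) }) ?_),
      h2.set hv, le_rfl⟩
    simp only [Instr.exec]
    rw [State.read_of_lt _ (by omega), Option.bind_some, h3, State.read_of_lt _ (by omega),
      Option.bind_some, h2.arr f _ h, State.write_of_lt _ (hl x) hv]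
  | @store f y x E h =>
    intro S hS
    obtain ⟨S', h1, h2, h3⟩ := exec_address (σ := σ) hS hW f h
    have hf := f.idx_lt
    have hv := h2.reg x ▸ h2.lt x.idx
    refine ⟨_, _, .seq h1 (.instr (S' :=
      { S' with mem := Function.update S'.mem (32 + 8 * E.reg y + f.idx) (E.reg x) }) ?_),
      h2.put hv, le_rfl⟩
    simp only [Instr.exec]
    rw [State.read_of_lt _ (by omega), Option.bind_some, h3, State.read_of_lt _ (hl x),
      Option.bind_some, h2.reg, State.write_of_lt _ (by omega) hv]
  | cmp hn hx hy hy' =>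
    intro S hS
    obtain ⟨t, S', v, ht, rfl, h1, h2⟩ := exec_cmp (σ := σ) hS hW hn hx hy hy'
    exact ⟨t, S', h1, h2, Nat.add_le_add_left ht _⟩
  | @output x E h =>
    intro S hS
    have hxW := hS.reg x ▸ hS.lt x.idx
    have h1 := hS.scratch (a := 28) (v := 1) (by omega) (by omega) (by omega)
    have h2 := h1.scratch (a := 28) (v := E.reg x - 1) (by omega) (by omega) (by omega)
    refine ⟨_, _, .seq (exec_const (by omega) (by omega)) (.seq (exec_arith (v := E.reg x - 1)
      (by omega) (hl x) (by omega) (by rw [h1.reg]; simp [Op.eval]) (by omega))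
      (.instr (S' := { mem := _, out := E.out ++ [⟨E.reg x - 1, h⟩] }) ?_)),
      ⟨h2.lt, h2.zero, h2.reg, h2.arr, rfl⟩, le_rfl⟩
    simp [Instr.exec, State.position, State.read_of_lt, show 28 < 32 + 8 * N by omega, h, hS.out]
  | seq _ _ ih ih' =>
    intro S hS
    obtain ⟨t, S', h1, h2, h3⟩ := ih hS
    obtain ⟨t', S'', h4, h5, h6⟩ := ih' h2
    exact ⟨_, _, .seq h1 h4, h5, by omega⟩
  | branch_true hb _ ih =>
    intro S hS
    obtain ⟨t, S', h1, h2, h3⟩ := ih hS.tick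
    exact ⟨_, _, .branch_true ((hS.test _).1 hb) h1, h2, by simp at h3; omega⟩
  | branch_false hb _ ih =>
    intro S hS
    obtain ⟨t, S', h1, h2, h3⟩ := ih hS.tick
    exact ⟨_, _, .branch_false ((hS.test _).2 hb) h1, h2, by simp at h3; omega⟩
  | loop_true hb _ _ ih ih' =>
    intro S hS
    obtain ⟨t, S', h1, h2, h3⟩ := ih hS.tick
    obtain ⟨t', S'', h4, h5, h6⟩ := ih' h2
    exact ⟨_, _, .loop_true ((hS.test _).1 hb) h1 h4, h5, by simp at h3; omega⟩
  | loop_false hb =>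
    intro S hS
    exact ⟨_, _, .loop_false ((hS.test _).2 hb), hS.tick, le_rfl⟩

/-! ### Weakest preconditions -/

/-- The command `c`, started in `E`, terminates in a state that satisfies `Q`. -/
def wp (σ : Fin n → ℤ) (N W : ℕ) (c : Cmd) (Q : Env n → Prop) (E : Env n) : Prop :=
  ∃ E', Run σ N W c E E' ∧ Q E'

variable {Q Q' : Env n → Prop}

theorem wp.mono {c : Cmd} (h : wp σ N W c Q E) (hQ : ∀ E', Q E' → Q' E') : wp σ N W c Q' E :=
  let ⟨E', h1, h2⟩ := h
  ⟨E', h1, hQ E' h2⟩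

@[simp] theorem wp_skip : wp σ N W .skip Q E ↔ Q E.tick :=
  ⟨fun ⟨_, h, h'⟩ => by cases h; exact h', fun h => ⟨_, .skip, h⟩⟩

@[simp] theorem wp_const {x : Reg} {v : ℕ} :
    wp σ N W (.const x v) Q E ↔ v < 2 ^ W ∧ Q (E.set x v 1) :=
  ⟨fun ⟨_, h, h'⟩ => by cases h with | const h => exact ⟨h, h'⟩, fun h => ⟨_, .const h.1, h.2⟩⟩

@[simp] theorem wp_copy {x y : Reg} : wp σ N W (.copy x y) Q E ↔ Q (E.set x (E.reg y) 1) :=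
  ⟨fun ⟨_, h, h'⟩ => by cases h; exact h', fun h => ⟨_, .copy, h⟩⟩

@[simp] theorem wp_arith {o : Op} {x y z : Reg} : wp σ N W (.arith o x y z) Q E ↔
    o.eval (E.reg y) (E.reg z) < 2 ^ W ∧ Q (E.set x (o.eval (E.reg y) (E.reg z)) 1) :=
  ⟨fun ⟨_, h, h'⟩ => by cases h with | arith h => exact ⟨h, h'⟩, fun h => ⟨_, .arith h.1, h.2⟩⟩

@[simp] theorem wp_arithConst {o : Op} {x y : Reg} {c : ℕ} :
    wp σ N W (.arithConst o x y c) Q E ↔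
      c < 2 ^ W ∧ o.eval (E.reg y) c < 2 ^ W ∧ Q (E.set x (o.eval (E.reg y) c) 2) :=
  ⟨fun ⟨_, h, h'⟩ => by cases h with | arithConst hc h => exact ⟨hc, h, h'⟩,
    fun h => ⟨_, .arithConst h.1 h.2.1, h.2.2⟩⟩

@[simp] theorem wp_load {x y : Reg} {f : Arr} : wp σ N W (.load x f y) Q E ↔
    E.reg y < N ∧ Q (E.set x (E.arr f (E.reg y)) 5) :=
  ⟨fun ⟨_, h, h'⟩ => by cases h with | load h => exact ⟨h, h'⟩, fun h => ⟨_, .load h.1, h.2⟩⟩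

@[simp] theorem wp_store {x y : Reg} {f : Arr} : wp σ N W (.store f y x) Q E ↔
    E.reg y < N ∧ Q (E.put f (E.reg y) (E.reg x) 5) :=
  ⟨fun ⟨_, h, h'⟩ => by cases h with | store h => exact ⟨h, h'⟩, fun h => ⟨_, .store h.1, h.2⟩⟩

@[simp] theorem wp_cmp {x y z : Reg} : wp σ N W (.cmp z x y) Q E ↔
    (E.reg .n = n ∧ E.reg x ≤ n ∧ 0 < E.reg y ∧ E.reg y ≤ n + 1) ∧
      Q (E.set z (if val σ (E.reg x) < val σ (E.reg y) then 1 else 0) 7) :=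
  ⟨fun ⟨_, h, h'⟩ => by cases h with | cmp h1 h2 h3 h4 => exact ⟨⟨h1, h2, h3, h4⟩, h'⟩,
    fun ⟨⟨h1, h2, h3, h4⟩, h⟩ => ⟨_, .cmp h1 h2 h3 h4, h⟩⟩

@[simp] theorem wp_output {x : Reg} : wp σ N W (.output x) Q E ↔ ∃ h : E.reg x - 1 < n,
    Q { E with out := E.out ++ [⟨E.reg x - 1, h⟩], time := E.time + 3 } :=
  ⟨fun ⟨_, h, h'⟩ => by cases h with | output h => exact ⟨h, h'⟩, fun h => ⟨_, .output h.1, h.2⟩⟩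

@[simp] theorem wp_seq {c d : Cmd} : wp σ N W (.seq c d) Q E ↔ wp σ N W c (wp σ N W d Q) E :=
  ⟨fun ⟨_, h, h'⟩ => by cases h with | seq h1 h2 => exact ⟨_, h1, _, h2, h'⟩,
    fun ⟨_, h1, _, h2, h3⟩ => ⟨_, .seq h1 h2, h3⟩⟩

@[simp] theorem wp_branch {b : Cond} {c d : Cmd} : wp σ N W (.branch b c d) Q E ↔
    (b.holds E → wp σ N W c Q E.tick) ∧ (¬ b.holds E → wp σ N W d Q E.tick) := by
  constructor
  · rintro ⟨_, h, h'⟩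
    cases h with
    | branch_true hb h => exact ⟨fun _ => ⟨_, h, h'⟩, fun hb' => absurd hb hb'⟩
    | branch_false hb h => exact ⟨fun hb' => absurd hb' hb, fun _ => ⟨_, h, h'⟩⟩
  · rintro ⟨h1, h2⟩
    by_cases hb : b.holds E
    · obtain ⟨_, h, h'⟩ := h1 hb
      exact ⟨_, .branch_true hb h, h'⟩
    · obtain ⟨_, h, h'⟩ := h2 hb
      exact ⟨_, .branch_false hb h, h'⟩

theorem wp_loop_true {b : Cond} {c : Cmd} (hb : b.holds E)
    (h : wp σ N W c (wp σ N W (.loop b c) Q) E.tick) : wp σ N W (.loop b c) Q E :=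
  let ⟨_, h1, _, h2, h3⟩ := h
  ⟨_, .loop_true hb h1 h2, h3⟩

theorem wp_loop_false {b : Cond} {c : Cmd} (hb : ¬ b.holds E) (h : Q E.tick) :
    wp σ N W (.loop b c) Q E :=
  ⟨_, .loop_false hb, h⟩

@[simp] theorem wp_block_nil : wp σ N W (.block []) Q E ↔ Q E.tick := wp_skip
@[simp] theorem wp_block_singleton {c : Cmd} : wp σ N W (.block [c]) Q E ↔ wp σ N W c Q E :=
  Iff.rfl
@[simp] theorem wp_block_cons {c d : Cmd} {l : List Cmd} :
    wp σ N W (.block (c :: d :: l)) Q E ↔ wp σ N W c (wp σ N W (.block (d :: l)) Q) E :=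
  wp_seq

/-! ### Frame conditions and the loop rule -/

/-- Whether a command can change a register. -/
def Cmd.writes (x : Reg) : Cmd → Bool
  | .const y _ | .copy y _ | .arith _ y _ _ | .arithConst _ y _ _ | .load y _ _ | .cmp y _ _ =>
      x = y
  | .seq c d | .branch _ c d => c.writes x || d.writes x
  | .loop _ c => c.writes x
  | _ => false

/-- Whether a command can change an array. -/
def Cmd.stores (f : Arr) : Cmd → Bool
  | .store g _ _ => f = g
  | .seq c d | .branch _ c d => c.stores f || d.stores f
  | .loop _ c => c.stores f
  | _ => false

/-- Whether a command can produce output. -/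
def Cmd.outputs : Cmd → Bool
  | .output _ => true
  | .seq c d | .branch _ c d => c.outputs || d.outputs
  | .loop _ c => c.outputs
  | _ => false

/-- What the command `c` cannot change is the same in `E` and in `E'`. -/
structure Frame (c : Cmd) (E E' : Env n) : Prop where
  reg : ∀ x, c.writes x = false → E'.reg x = E.reg x
  arr : ∀ f, c.stores f = false → E'.arr f = E.arr f
  out : c.outputs = false → E'.out = E.out

/-- The syntactic checks compute, so for a concrete command the facts about unchanged registers and
arrays follow by `rfl`. -/
theorem Run.frame {c : Cmd} {E E' : Env n} (h : Run σ N W c E E') : Frame c E E' := by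
  induction h with
  | seq _ _ ih ih' =>
    refine ⟨fun x hx => ?_, fun f hf => ?_, fun ho => ?_⟩
    · simp only [Cmd.writes, Bool.or_eq_false_iff] at hx
      rw [ih'.reg x hx.2, ih.reg x hx.1]
    · simp only [Cmd.stores, Bool.or_eq_false_iff] at hf
      rw [ih'.arr f hf.2, ih.arr f hf.1]
    · simp only [Cmd.outputs, Bool.or_eq_false_iff] at ho
      rw [ih'.out ho.2, ih.out ho.1]
  | branch_true _ _ ih =>
    refine ⟨fun x hx => ?_, fun f hf => ?_, fun ho => ?_⟩
    · simp only [Cmd.writes, Bool.or_eq_false_iff] at hx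
      exact ih.reg x hx.1
    · simp only [Cmd.stores, Bool.or_eq_false_iff] at hf
      exact ih.arr f hf.1
    · simp only [Cmd.outputs, Bool.or_eq_false_iff] at ho
      exact ih.out ho.1
  | branch_false _ _ ih =>
    refine ⟨fun x hx => ?_, fun f hf => ?_, fun ho => ?_⟩
    · simp only [Cmd.writes, Bool.or_eq_false_iff] at hx
      exact ih.reg x hx.2
    · simp only [Cmd.stores, Bool.or_eq_false_iff] at hf
      exact ih.arr f hf.2
    · simp only [Cmd.outputs, Bool.or_eq_false_iff] at ho
      exact ih.out ho.2
  | loop_true _ _ _ ih ih' =>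
    exact ⟨fun x hx => by rw [ih'.reg x hx, ih.reg x hx]; rfl,
      fun f hf => by rw [ih'.arr f hf, ih.arr f hf]; rfl,
      fun ho => by rw [ih'.out ho, ih.out ho]; rfl⟩
  | store _ =>
    refine ⟨fun x _ => rfl, fun f hf => ?_, fun _ => rfl⟩
    simp only [Cmd.stores, decide_eq_false_iff_not] at hf
    simp [hf]
  | output _ => exact ⟨fun x _ => rfl, fun f _ => rfl, fun ho => by simp [Cmd.outputs] at ho⟩
  | skip => exact ⟨fun x _ => rfl, fun f _ => rfl, fun _ => rfl⟩
  | loop_false => exact ⟨fun x _ => rfl, fun f _ => rfl, fun _ => rfl⟩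
  | _ =>
    refine ⟨fun x hx => ?_, fun f _ => rfl, fun _ => rfl⟩
    simp only [Cmd.writes, decide_eq_false_iff_not] at hx
    simp [hx]

theorem wp.frame {c : Cmd} (h : wp σ N W c Q E) :
    wp σ N W c (fun E' => Q E' ∧ Frame c E E') E :=
  let ⟨_, h1, h2⟩ := h
  ⟨_, h1, h2, h1.frame⟩

/-- The rule for loops, with an invariant that depends on a decreasing measure. -/
theorem wp_loop {b : Cond} {c : Cmd} (I : ℕ → Env n → Prop) (k : ℕ) (h0 : I k E)
    (hstep : ∀ k E', Frame c E E' → I k E' → b.holds E' →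
      wp σ N W c (fun E'' => ∃ k' < k, I k' E'') E'.tick)
    (hexit : ∀ k E', Frame c E E' → I k E' → ¬ b.holds E' → Q E'.tick) :
    wp σ N W (.loop b c) Q E := by
  suffices H : ∀ k E', Frame c E E' → I k E' → wp σ N W (.loop b c) Q E' from
    H k E ⟨fun _ _ => rfl, fun _ _ => rfl, fun _ => rfl⟩ h0
  intro k
  induction k using Nat.strong_induction_on with
  | _ k ih =>
    intro E' hF hI
    by_cases hb : b.holds E'
    · refine wp_loop_true hb ((hstep k E' hF hI hb).frame.mono ?_)
      rintro E'' ⟨⟨k', hk', hI'⟩, hF'⟩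
      exact ih k' hk' E'' ⟨fun x hx => (hF'.reg x hx).trans (hF.reg x hx),
        fun f hf => (hF'.arr f hf).trans (hF.arr f hf), fun ho => (hF'.out ho).trans (hF.out ho)⟩
        hI'
    · exact wp_loop_false hb (hexit k E' hF hI hb)

end RAM

/-! ### One pass over the input -/

namespace RAM

open LIS

variable {n : ℕ} {σ : Fin n → ℤ} {N W : ℕ} {E : Env n} {Q : Env n → Prop}

/-- Doubling `z` until it is at least `x`. -/
def powerLoop : Cmd := .loop (.lt .z .x) (.arith .add .z .z .z)

/-- Replacing `y` by `j` if the rank `i + lo` is a power of two. -/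
def choosePivot : Cmd := .block [.arith .add .x .i .lo, .const .z 1, powerLoop,
  .branch (.le .z .x) (.copy .y .j) .skip]

/-- Binary search for the last pile whose top is less than the element at position `j`. -/
def search : Cmd := .loop (.lt .lo .hi) (.block [
  .arith .add .mid .lo .hi, .arithConst .div .mid .mid 2, .arithConst .add .mid .mid 1,
  .load .y .top .mid, .cmp .z .y .j,
  .branch (.pos .z) (.copy .lo .mid) (.arithConst .sub .hi .mid 1)])

/-- Starting the pile `lo` if it does not exist. -/
def newPile : Cmd :=
  .branch (.lt .m .lo) (.block [.copy .m .lo, .const .x 0, .store .cnt .lo .x]) .skip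

/-- Recording the position `j` with its pivot `y` if it belongs to pile `r`. -/
def record : Cmd :=
  .branch (.le .r .lo)
    (.branch (.le .lo .r) (.block [.store .buf .x .j, .store .bufAnc .x .y]) .skip) .skip

/-- Placing the element at position `j` on the pile after the pile `lo`. -/
def place : Cmd := .block [.load .y .anc .lo, .arithConst .add .lo .lo 1, choosePivot, newPile,
  .store .top .lo .j, .store .anc .lo .y, .load .x .cnt .lo, record,
  .arithConst .add .x .x 1, .store .cnt .lo .x]

/-- Placing the element at position `j` if its rank exceeds that of the base pile. -/
def consider : Cmd := .block [.const .lo 0, .load .y .top .lo, .cmp .z .y .j,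
  .branch (.pos .z) (.block [.copy .hi .m, search, .branch (.lt .lo .s) place .skip]) .skip]

/-- Processing the element at position `j`. -/
def passStep : Cmd := .block [.load .x .base .p,
  .branch (.le .x .j)
    (.block [.const .z 0, .store .top .z .j, .load .y .baseAnc .p, .store .anc .z .y,
      .arithConst .add .p .p 1])
    (.branch (.pos .p) (.block [.cmp .z .j .b, .branch (.pos .z) consider .skip]) .skip)]

/-- One pass over the input: given the base pile, which has rank `i`, the next `s` piles are
built, and the pile of rank `i + r` is recorded. -/
def pass : Cmd := .block [.const .m 0, .copy .j .a, .const .p 0,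
  .loop (.lt .j .b) (.block [passStep, .arithConst .add .j .j 1])]

/-- The register `z` runs through the powers of two and stops at the first one that is at least `X`,
so it is at most `X` exactly if `X` is a power of two. -/
theorem wp_powerLoop {ℓ X : ℕ} (hW : 100 * (n + 1) < 2 ^ W) (hn : n < 2 ^ ℓ)
    (hx : E.reg .x = X) (hX : X ≤ n) (hX0 : 0 < X) (hz : E.reg .z = 1) :
    wp σ N W powerLoop (fun E' => (E'.reg .z ≤ X ↔ ∃ t, X = 2 ^ t) ∧
      E'.time ≤ E.time + 2 * ℓ + 1) E := by
  -- The bound `2 ^ t < 2 * X` records that the last doubling took place below `X`; `X ≤ n < 2 ^ ℓ`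
  -- limits the number of doublings.
  refine wp_loop (fun k E' => ∃ t, t + k = ℓ ∧ E'.reg .z = 2 ^ t ∧ (t ≠ 0 → 2 ^ t < 2 * X) ∧
    E'.time = E.time + 2 * t) ℓ ⟨0, by simp, by simpa using hz, by simp, by simp⟩ ?_ ?_
  · rintro k E' hF ⟨t, h1, h2, h3, h4⟩ hb
    have hx' : E'.reg .x = X := (hF.reg .x rfl).trans hx
    simp only [Cond.holds_lt, h2, hx'] at hb
    have : t < ℓ := (Nat.pow_lt_pow_iff_right (by omega : 1 < 2)).1 (by omega)
    simp only [wp_arith, Op.eval, Env.reg_tick, h2, Env.reg_set, if_true, Env.time_set,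
      Env.time_tick, h4]
    refine ⟨by omega, k - 1, by omega, t + 1, by omega, by rw [pow_succ]; omega,
      fun _ => by rw [pow_succ]; omega, by omega⟩
  · rintro k E' hF ⟨t, h1, h2, h3, h4⟩ hb
    have hx' : E'.reg .x = X := (hF.reg .x rfl).trans hx
    simp only [Cond.holds_lt, h2, hx'] at hb
    simp only [Env.reg_tick, Env.time_tick, h2, h4]
    refine ⟨⟨fun h => ⟨t, by omega⟩, ?_⟩, by omega⟩
    rintro ⟨t', ht'⟩
    by_cases ht : t = 0
    · subst ht
      omega
    · have h3' := h3 ht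
      rw [ht', ← pow_succ'] at h3'
      have := (Nat.pow_lt_pow_iff_right (by omega : 1 < 2)).1 h3'
      rw [ht']
      exact Nat.pow_le_pow_right (by omega) (by omega)

theorem wp_choosePivot {ℓ X : ℕ} (hW : 100 * (n + 1) < 2 ^ W) (hn : n < 2 ^ ℓ)
    (hx : E.reg .i + E.reg .lo = X) (hX : X ≤ n) (hX0 : 0 < X) :
    wp σ N W choosePivot (fun E' => ((∃ t, X = 2 ^ t) → E'.reg .y = E.reg .j) ∧
      ((∀ t, X ≠ 2 ^ t) → E'.reg .y = E.reg .y) ∧ E'.time ≤ E.time + 2 * ℓ + 6) E := by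
  simp only [choosePivot, wp_block_cons, wp_arith, Op.eval, wp_const, hx]
  refine ⟨by omega, by omega, ?_⟩
  refine (wp_powerLoop (X := X) (ℓ := ℓ) hW hn (by simp) hX hX0 (by simp)).frame.mono ?_
  rintro E' ⟨⟨h1, h2⟩, hF⟩
  have hy := hF.reg .y rfl
  have hj := hF.reg .j rfl
  have hx' := hF.reg .x rfl
  simp only [Env.reg_set, reduceCtorEq, if_false, if_true, Env.time_set] at hy hj hx' h2
  simp only [wp_block_singleton, wp_branch, Cond.holds_le, hx', h1, wp_copy, wp_skip,
    Env.reg_tick, Env.reg_set, Env.time_set, Env.time_tick, hj, hy, if_true]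
  refine ⟨fun h => ⟨fun _ => trivial, fun h' => ?_, by omega⟩,
    fun h => ⟨fun h' => absurd h' h, fun _ => trivial, by omega⟩⟩
  obtain ⟨t, ht⟩ := h
  exact absurd ht (h' t)

/-- Here `K` is the rank of the element at `j` relative to the base pile. If the search ends at `lo
= m`, no pile bounds `K` from above, which is why that bound is conditional. -/
theorem wp_search {ℓ s j K m : ℕ} (hW : 100 * (n + 1) < 2 ^ W) (hn : n < 2 ^ ℓ) (hs : s ≤ n)
    (hN : N = 4 * s + 4) (hrn : E.reg .n = n) (hj : E.reg .j = j) (hj0 : 0 < j)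
    (hjn : j ≤ n) (hlo : E.reg .lo = 0) (hhi : E.reg .hi = m) (hm : m ≤ s)
    (hK : 0 < K) (htop : ∀ k, 0 < k → k ≤ m → E.arr .top k ≤ n ∧
      (val σ (E.arr .top k) < val σ j ↔ k < K)) :
    wp σ N W search (fun E' => E'.reg .lo ≤ m ∧ E'.reg .lo < K ∧
      (E'.reg .lo < m → K ≤ E'.reg .lo + 1) ∧ E'.time ≤ E.time + 21 * ℓ + 1) E := by
  -- The length of the search interval is below `2 ^ k`, and rounding the midpoint up makes it
  -- shrink in both cases. One round costs `21` units, including the test.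
  refine wp_loop (fun k E' => E'.reg .lo ≤ E'.reg .hi ∧ E'.reg .hi ≤ m ∧
    E'.reg .hi - E'.reg .lo < 2 ^ k ∧ E'.reg .lo < K ∧ (E'.reg .hi < m → K ≤ E'.reg .hi + 1) ∧
    E'.time + 21 * k ≤ E.time + 21 * ℓ) ℓ ⟨by omega, by omega, by omega, by omega, by omega, le_rfl⟩
    ?_ ?_
  · rintro k E' hF ⟨h1, h2, h3, h4, h5, h6⟩ hb
    simp only [Cond.holds_lt] at hb
    have hk : k ≠ 0 := by
      rintro rfl
      simp at h3
      omega
    obtain ⟨k, rfl⟩ := Nat.exists_eq_succ_of_ne_zero hk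
    have e1 := hF.reg .n rfl
    have e2 := hF.reg .j rfl
    have e3 := hF.arr .top rfl
    rw [hrn] at e1
    rw [hj] at e2
    obtain ⟨g1, g2⟩ := htop ((E'.reg .lo + E'.reg .hi) / 2 + 1) (by omega) (by omega)
    rw [pow_succ] at h3
    simp only [wp_block_cons, wp_block_singleton, wp_arith, wp_arithConst, wp_load, wp_cmp,
      wp_branch, wp_copy, Op.eval, Env.reg_tick, Env.reg_set, Env.arr_set, Env.arr_tick,
      Env.time_set, Env.time_tick, reduceCtorEq, if_false, if_true, Cond.holds_pos, e1, e2, e3, g2]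
    refine ⟨by omega, by omega, by omega, by omega, by omega, by omega,
      ⟨trivial, g1, hj0, by omega⟩, fun h => ⟨k, by omega, ?_⟩,
      fun h => ⟨by omega, by omega, k, by omega, ?_⟩⟩
    · have : (E'.reg .lo + E'.reg .hi) / 2 + 1 < K := by
        by_contra hcon
        simp [hcon] at h
      exact ⟨by omega, by omega, by omega, by omega, by omega, by omega⟩
    · have : ¬ (E'.reg .lo + E'.reg .hi) / 2 + 1 < K := by
        intro hcon
        simp [hcon] at h
      exact ⟨by omega, by omega, by omega, by omega, by omega, by omega⟩
  · rintro k E' hF ⟨h1, h2, h3, h4, h5, h6⟩ hb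
    simp only [Cond.holds_lt] at hb
    simp only [Env.reg_tick, Env.time_tick]
    exact ⟨by omega, by omega, by omega, by omega⟩

/-! ### Invariants of a pass -/

/-- The state of a pass before position `j` is processed: `p` elements of the base pile have been
found, and `m` further piles have been started. -/
structure PassInv {α : Type*} [LinearOrder α] (v : ℕ → α) (a b i s r j p m : ℕ)
    (top anc cnt buf bufAnc : ℕ → ℕ) : Prop where
  p_eq : p = count v a b i j
  m_le : m ≤ s
  isTop : ∀ k, k ≤ m → (k = 0 → 0 < p) →
    IsTop v a b j (i + k) (top k) ∧ Pivot v a b (top k) (anc k)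
  cnt_eq : ∀ k, 0 < k → k ≤ m → cnt k = count v a b (i + k) j
  ne : ∀ k, m < k → k ≤ s → ∀ x < j, Good v a b x → rank v a b x ≠ i + k
  recorded : 0 < r → ∀ x < j, Good v a b x → rank v a b x = i + r →
    buf (count v a b (i + r) x) = x ∧ Pivot v a b x (bufAnc (count v a b (i + r) x))

section math

variable {α : Type*} [LinearOrder α] {v : ℕ → α} {a b i s r j p m : ℕ}
  {top anc cnt buf bufAnc : ℕ → ℕ}

/-- Elements that are not admissible, or whose rank is outside the window from `i` to `i + s`,
affect none of the piles under construction. -/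
theorem PassInv.skip (h : PassInv v a b i s r j p m top anc cnt buf bufAnc) (hr : r ≤ s)
    (hj : Good v a b j → rank v a b j < i ∨ i + s < rank v a b j) :
    PassInv v a b i s r (j + 1) p m top anc cnt buf bufAnc where
  p_eq := by
    rw [h.p_eq, count_succ_of_not]
    intro hg
    have := hj hg
    omega
  m_le := h.m_le
  isTop k hk h0 := by
    refine ⟨(h.isTop k hk h0).1.succ fun hg => ?_, (h.isTop k hk h0).2⟩
    have := hj hg
    have := h.m_le
    omega
  cnt_eq k h0 hk := by
    rw [h.cnt_eq k h0 hk, count_succ_of_not]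
    intro hg
    have := hj hg
    have := h.m_le
    omega
  ne k hk hks x hx hg := by
    rcases Nat.lt_succ_iff_lt_or_eq.1 hx with h' | rfl
    · exact h.ne k hk hks x h' hg
    · have := hj hg
      omega
  recorded h0 x hx hg hxr := by
    rcases Nat.lt_succ_iff_lt_or_eq.1 hx with h' | rfl
    · exact h.recorded h0 x h' hg hxr
    · have := hj hg
      omega

theorem PassInv.base (h : PassInv v a b i s r j p m top anc cnt buf bufAnc)
    (hg : Good v a b j) (hj : rank v a b j = i) {A : ℕ} (hA : Pivot v a b j A) :
    PassInv v a b i s r (j + 1) (p + 1) m (Function.update top 0 j) (Function.update anc 0 A)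
      cnt buf bufAnc where
  p_eq := by rw [h.p_eq, count_succ_of hg hj]
  m_le := h.m_le
  isTop k hk h0 := by
    rcases Nat.eq_zero_or_pos k with rfl | hk0
    · simp only [Function.update_self]
      exact ⟨hj ▸ isTop_succ_self hg, hA⟩
    · obtain ⟨h1, h2⟩ := h.isTop k hk (by omega)
      rw [Function.update_of_ne (by omega), Function.update_of_ne (by omega)]
      exact ⟨h1.succ fun _ => by omega, h2⟩
  cnt_eq k h0 hk := by
    rw [h.cnt_eq k h0 hk, count_succ_of_not]
    intro
    omega
  ne k hk hks x hx hg := by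
    rcases Nat.lt_succ_iff_lt_or_eq.1 hx with h' | rfl
    · exact h.ne k hk hks x h' hg
    · omega
  recorded h0 x hx hg hxr := by
    rcases Nat.lt_succ_iff_lt_or_eq.1 hx with h' | rfl
    · exact h.recorded h0 x h' hg hxr
    · omega

/-- The pile size before insertion is the index at which `j` is recorded if its pile is pile `r`.
The updated arrays are left abstract because they come from several commands. -/
theorem PassInv.place (h : PassInv v a b i s r j p m top anc cnt buf bufAnc)
    (hg : Good v a b j) {k : ℕ} (hj : rank v a b j = i + k) (hk0 : 0 < k) (hks : k ≤ s)
    (hkm : k ≤ m + 1) {A : ℕ} (hA : Pivot v a b j A) {m' : ℕ} (hm' : m' = max m k)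
    {cnt' buf' bufAnc' : ℕ → ℕ}
    (hcnt : cnt' k = count v a b (i + k) j + 1) (hcnt' : ∀ k' ≠ k, cnt' k' = cnt k')
    (hbuf : r = k → buf' = Function.update buf (count v a b (i + k) j) j ∧
      bufAnc' = Function.update bufAnc (count v a b (i + k) j) A)
    (hbuf' : r ≠ k → buf' = buf ∧ bufAnc' = bufAnc) :
    PassInv v a b i s r (j + 1) p m' (Function.update top k j) (Function.update anc k A)
      cnt' buf' bufAnc' where
  p_eq := by
    rw [h.p_eq, count_succ_of_not]
    intro hg
    omega
  m_le := by have := h.m_le; omega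
  isTop k' hk' h0 := by
    by_cases hkk : k' = k
    · subst hkk
      simp only [Function.update_self]
      exact ⟨hj ▸ isTop_succ_self hg, hA⟩
    · obtain ⟨h1, h2⟩ := h.isTop k' (by omega) h0
      rw [Function.update_of_ne hkk, Function.update_of_ne hkk]
      exact ⟨h1.succ fun _ => by omega, h2⟩
  cnt_eq k' h0 hk' := by
    by_cases hkk : k' = k
    · subst hkk
      rw [hcnt, count_succ_of hg hj]
    · rw [hcnt' k' hkk, h.cnt_eq k' h0 (by omega), count_succ_of_not]
      intro
      omega
  ne k' hk' hks x hx hg := by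
    rcases Nat.lt_succ_iff_lt_or_eq.1 hx with h' | rfl
    · exact h.ne k' (by omega) hks x h' hg
    · omega
  recorded h0 x hx hgx hxr := by
    by_cases hrk : r = k
    · obtain ⟨rfl, rfl⟩ := hbuf hrk
      subst hrk
      rcases Nat.lt_succ_iff_lt_or_eq.1 hx with h' | rfl
      · have := count_lt hgx hxr h'
        rw [Function.update_of_ne (by omega), Function.update_of_ne (by omega)]
        exact h.recorded h0 x h' hgx hxr
      · simp only [Function.update_self]
        exact ⟨trivial, hA⟩
    · obtain ⟨rfl, rfl⟩ := hbuf' hrk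
      rcases Nat.lt_succ_iff_lt_or_eq.1 hx with h' | rfl
      · exact h.recorded h0 x h' hgx hxr
      · omega

/-- The arrays `base` and `baseAnc` hold the pile of rank `i`, with pivots. -/
structure BaseInv (v : ℕ → α) (a b i s : ℕ) (base baseAnc : ℕ → ℕ) : Prop where
  elem : ∀ x, Good v a b x → rank v a b x = i →
    base (count v a b i x) = x ∧ Pivot v a b x (baseAnc (count v a b i x))
  last : base (count v a b i b) = b
  pos : 0 < count v a b i b
  le : count v a b i b ≤ 2 * s + 1

/-- The base pile is stored in order of position, with `b` behind it. The entry at index `count v a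
b i j` is therefore the first base position not before `j`, and one comparison of positions decides
membership. -/
theorem BaseInv.next {base baseAnc : ℕ → ℕ} (h : BaseInv v a b i s base baseAnc)
    (hab : Prec v a b) (hj : j < b) :
    base (count v a b i j) ≤ j ↔ Good v a b j ∧ rank v a b j = i := by
  constructor
  · intro hle
    rcases exists_next (k := i) hab hj.le with ⟨x, h1, h2, h3, h4, h5⟩ | h1
    · have := (h.elem x h3 h4).1
      rw [h5] at this
      obtain rfl : x = j := by omega
      exact ⟨h3, h4⟩
    · rw [← h1, h.last] at hle
      omega
  · rintro ⟨h1, h2⟩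
    exact (h.elem j h1 h2).1.le

end math

/-- Counters are reset only when a pile is started, so stale entries do no harm and a pass spends no
time proportional to `s` on clearing arrays. -/
theorem wp_newPile {s : ℕ} (hN : N = 4 * s + 4) (hlo : E.reg .lo ≤ s) (hW : 0 < 2 ^ W) :
    wp σ N W newPile (fun E' => E'.reg .m = max (E.reg .m) (E.reg .lo) ∧
      E'.arr .cnt (E.reg .lo) = (if E.reg .m < E.reg .lo then 0 else E.arr .cnt (E.reg .lo)) ∧
      (∀ k ≠ E.reg .lo, E'.arr .cnt k = E.arr .cnt k) ∧ E'.time ≤ E.time + 8) E := by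
  simp only [newPile, wp_branch, wp_block_cons, wp_block_singleton, wp_copy, wp_const, wp_store,
    wp_skip, Cond.holds_lt, Env.reg_tick, Env.reg_set, Env.reg_put, Env.arr_set, Env.arr_put,
    Env.arr_tick, Env.time_set, Env.time_put, Env.time_tick, reduceCtorEq, if_true, if_false]
  refine ⟨fun h => ⟨hW, by omega, by omega, by simp [h], fun k hk => by simp [hk], by omega⟩,
    fun h => ⟨by omega, by simp [h], fun _ _ => trivial, by omega⟩⟩

theorem wp_record (hx : E.reg .lo = E.reg .r → E.reg .x < N) :
    wp σ N W record (fun E' => (E.reg .r = E.reg .lo →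
      E'.arr .buf = Function.update (E.arr .buf) (E.reg .x) (E.reg .j) ∧
      E'.arr .bufAnc = Function.update (E.arr .bufAnc) (E.reg .x) (E.reg .y)) ∧
      (E.reg .r ≠ E.reg .lo → E'.arr .buf = E.arr .buf ∧ E'.arr .bufAnc = E.arr .bufAnc) ∧
      E'.time ≤ E.time + 12) E := by
  simp only [record, wp_branch, wp_block_cons, wp_block_singleton, wp_store,
    wp_skip, Cond.holds_le, Env.reg_tick, Env.reg_put, Env.arr_put,
    Env.arr_tick, Env.time_put, Env.time_tick, reduceCtorEq, if_true, if_false]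
  refine ⟨fun h1 => ⟨fun h2 => ?_, fun h2 => ?_⟩, fun h1 => ?_⟩
  · have := hx (by omega)
    exact ⟨this, this, fun _ => ⟨trivial, trivial⟩, fun h => absurd (h1.antisymm h2) h, by omega⟩
  · exact ⟨fun h => absurd h.ge h2, fun _ => ⟨trivial, trivial⟩, by omega⟩
  · exact ⟨fun h => absurd h.le h1, fun _ => ⟨trivial, trivial⟩, by omega⟩

/-- The invariant of a pass, for the registers and arrays in `E`. -/
abbrev Passing {α : Type*} [LinearOrder α] (v : ℕ → α) (a b i s r j : ℕ) (E : Env n) : Prop :=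
  PassInv v a b i s r j (E.reg .p) (E.reg .m) (E.arr .top) (E.arr .anc) (E.arr .cnt) (E.arr .buf)
    (E.arr .bufAnc)

/-- The top of pile `lo` precedes `j` and has rank one less, so its pivot is the one to inherit. The
bound `hcap` keeps the recorded pile inside its array. -/
theorem wp_place {a b i s r j ℓ : ℕ} (hW : 100 * (n + 1) < 2 ^ W) (hn : n < 2 ^ ℓ)
    (hN : N = 4 * s + 4) (hab : Prec (val σ) a b) (hb : b ≤ n + 1)
    (hri : E.reg .i = i) (hrr : E.reg .r = r) (hrj : E.reg .j = j)
    (h : Passing (val σ) a b i s r j E) (hg : Good (val σ) a b j)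
    (hcap : 0 < r → count (val σ) a b (i + r) b ≤ 2 * s + 1)
    (hj : rank (val σ) a b j = i + E.reg .lo + 1) (hlos : E.reg .lo < s)
    (hlom : E.reg .lo ≤ E.reg .m) (hp : 0 < E.reg .p) :
    wp σ N W place (fun E' => Passing (val σ) a b i s r (j + 1) E' ∧
      E'.time ≤ E.time + 2 * ℓ + 60) E := by
  obtain ⟨hT, hA⟩ := h.isTop _ hlom (fun _ => hp)
  have hprec : Prec (val σ) (E.arr .top (E.reg .lo)) j :=
    ⟨hT.2.1, hT.lt_iff.2 (by omega)⟩
  have hjb := (hg.prec hab).1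
  have hrk := hg.rank_add_le
  simp only [place, wp_block_cons, wp_load, wp_arithConst, Op.eval, Env.reg_set, reduceCtorEq,
    if_false]
  refine ⟨by omega, by omega, by omega, ?_⟩
  refine (wp_choosePivot (X := i + (E.reg .lo + 1)) (ℓ := ℓ) hW hn (by simp [hri]) (by omega)
    (by omega)).frame.mono ?_
  rintro E₁ ⟨⟨hy1, hy2, ht1⟩, hF1⟩
  have hlo1 := hF1.reg .lo rfl
  have hm1 := hF1.reg .m rfl
  have hr1 := hF1.reg .r rfl
  have hj1 := hF1.reg .j rfl
  have hp1 := hF1.reg .p rfl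
  have hA1 := fun f => hF1.arr f rfl
  simp only [Env.reg_set, Env.arr_set, reduceCtorEq, if_false, if_true, hrj, hrr,
    Env.time_set] at hlo1 hm1 hr1 hj1 hA1 hy1 hy2 ht1 hp1
  have hpiv : Pivot (val σ) a b j (E₁.reg .y) := by
    by_cases hpow : ∃ t, i + (E.reg .lo + 1) = 2 ^ t
    · rw [hy1 hpow]
      obtain ⟨t, ht⟩ := hpow
      exact pivot_self hg (by rw [hj, ← ht]; ring)
    · push Not at hpow
      rw [hy2 hpow]
      refine hA.step hprec ?_ fun t => ?_
      · rw [hT.2.2.1, hj]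
      · rw [hj]
        have := hpow t
        omega
  refine wp_block_cons.2 ((wp_newPile (s := s) hN (by omega) (by omega)).frame.mono ?_)
  rintro E₂ ⟨⟨hm2, hc2, hc2', ht2⟩, hF2⟩
  have hlo2 := hF2.reg .lo rfl
  have hr2 := hF2.reg .r rfl
  have hj2 := hF2.reg .j rfl
  have hy2 := hF2.reg .y rfl
  have hp2 := hF2.reg .p rfl
  have htop2 := hF2.arr .top rfl
  have hanc2 := hF2.arr .anc rfl
  have hbuf2 := hF2.arr .buf rfl
  have hbufAnc2 := hF2.arr .bufAnc rfl
  simp only [hlo1, hm1, hr1, hj1, hA1, hp1]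
    at hm2 hc2 hc2' hlo2 hr2 hj2 htop2 hanc2 hbuf2 hbufAnc2 hp2
  have hcount : E₂.arr .cnt (E.reg .lo + 1) = count (val σ) a b (i + (E.reg .lo + 1)) j := by
    rw [hc2]
    split_ifs with hlt
    · symm
      rw [← Nat.le_zero, ← not_lt, count_pos_iff]
      rintro ⟨x, hx, hgx, hrx⟩
      exact h.ne _ hlt (by omega) x hx hgx hrx
    · exact h.cnt_eq _ (by omega) (by omega)
  simp only [wp_block_cons, wp_store, wp_load, Env.reg_put, Env.arr_put, reduceCtorEq, if_false,
    hlo2]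
  refine ⟨by omega, by omega, by omega, ?_⟩
  refine (wp_record ?_).frame.mono ?_
  · simp only [Env.reg_set, Env.reg_put, reduceCtorEq, if_false, if_true, hlo2, hr2, hcount]
    rintro rfl
    have := hcap (by omega)
    have := count_mono (v := val σ) (a := a) (b := b) (k := i + (E.reg .lo + 1)) hjb.le
    omega
  rintro E₃ ⟨⟨hb3, hb3', ht3⟩, hF3⟩
  have hlo3 := hF3.reg .lo rfl
  have hm3 := hF3.reg .m rfl
  have hx3 := hF3.reg .x rfl
  have hp3 := hF3.reg .p rfl
  have htop3 := hF3.arr .top rfl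
  have hanc3 := hF3.arr .anc rfl
  have hcnt3 := hF3.arr .cnt rfl
  simp only [Env.reg_set, Env.arr_set, Env.reg_put, Env.arr_put, reduceCtorEq, if_false, if_true,
    Env.time_put, Env.time_set, hlo2, hr2, hj2, hy2, hm2, htop2, hanc2, hbuf2, hbufAnc2, hcount,
    hp2] at hlo3 hm3 hx3 hp3 htop3 hanc3 hcnt3 hb3 hb3' ht3
  have hcj : count (val σ) a b (i + (E.reg .lo + 1)) j ≤ j - a := count_le
  simp only [wp_block_cons, wp_block_singleton, wp_arithConst, wp_store, Op.eval, Env.reg_set,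
    Env.arr_set, Env.reg_put, Env.arr_put, reduceCtorEq, if_false, if_true, Env.time_put,
    Env.time_set, hlo3, hx3, hm3, htop3, hanc3, hcnt3, hp3, Passing]
  refine ⟨by omega, by omega, by omega, ?_, by omega⟩
  refine h.place hg (by rw [hj]; ring) (by omega) (by omega) (by omega) hpiv rfl (by simp)
    (fun k' hk' => ?_) hb3 hb3'
  rw [Function.update_of_ne hk', hc2' k' hk']

/-- An element of the base pile only updates pile `0`. Any other element is skipped if no base
element has been met, if its value is not below that of `b`, or if the base top is not smaller: then
it is not admissible or has rank below `i`. In the remaining case binary search yields its rank, or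
shows that it exceeds `i + s`. -/
theorem wp_passStep {a b i s r j ℓ : ℕ} (hW : 100 * (n + 1) < 2 ^ W) (hn : n < 2 ^ ℓ)
    (hs : s ≤ n) (hN : N = 4 * s + 4) (hab : Prec (val σ) a b) (hb : b ≤ n + 1)
    (hrn : E.reg .n = n) (hrs : E.reg .s = s) (hrb : E.reg .b = b)
    (hri : E.reg .i = i) (hrr : E.reg .r = r) (hrj : E.reg .j = j)
    (h : Passing (val σ) a b i s r j E) (hrs' : r ≤ s)
    (hbase : BaseInv (val σ) a b i s (E.arr .base) (E.arr .baseAnc))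
    (hcap : 0 < r → count (val σ) a b (i + r) b ≤ 2 * s + 1)
    (hjb : j < b) :
    wp σ N W passStep (fun E' => Passing (val σ) a b i s r (j + 1) E' ∧
      E'.time ≤ E.time + 23 * ℓ + 100) E := by
  have hpe := h.p_eq
  have hpb := count_mono (v := val σ) (a := a) (b := b) (k := i) hjb.le
  have hle := hbase.le
  have hnext := hbase.next hab hjb
  rw [← hpe] at hnext hpb
  simp only [passStep, wp_block_cons, wp_block_singleton, wp_load, wp_branch, Cond.holds_le,
    wp_const, wp_store, wp_arithConst, wp_cmp, wp_skip, Cond.holds_pos, Op.eval,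
    Env.reg_set, Env.arr_set, Env.reg_put, Env.arr_put, Env.reg_tick, Env.arr_tick, Env.time_set,
    Env.time_put, Env.time_tick, reduceCtorEq, if_false, if_true, hrj, hrb, hrn, hnext]
  refine ⟨by omega, fun hbj => ?_, fun hbj => ⟨fun hp => ⟨⟨trivial, by omega, by omega, by omega⟩,
    fun hz => ?_, fun hz => ⟨?_, by omega⟩⟩, fun hp => ⟨?_, by omega⟩⟩⟩
  · have := count_le (v := val σ) (a := a) (b := b) (k := i) (j := b)
    refine ⟨by omega, by omega, by omega, by omega, by omega, by omega, ?_, by omega⟩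
    have := (hbase.elem j hbj.1 hbj.2).2
    rw [← hpe] at this
    exact h.base hbj.1 hbj.2 this
  · have hvb : val σ j < val σ b := by
      by_contra hcon
      simp [hcon] at hz
    obtain ⟨hT, hA⟩ := h.isTop 0 (by omega) (fun _ => hp)
    simp only [consider, wp_block_cons, wp_block_singleton, wp_load, wp_branch, Cond.holds_pos,
      wp_const, wp_cmp, wp_copy, wp_skip, Env.reg_set, Env.arr_set, Env.reg_tick, Env.arr_tick,
      Env.time_set, Env.time_tick, reduceCtorEq, if_false, if_true, hrj, hrn]
    have hTj := hT.2.1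
    refine ⟨by omega, by omega, ⟨trivial, by omega, by omega, by omega⟩, fun hz' => ?_,
      fun hz' => ⟨?_, by omega⟩⟩
    · have hvt : val σ (E.arr .top 0) < val σ j := by
        by_contra hcon
        simp [hcon] at hz'
      have hg : Good (val σ) a b j := hT.1.of_prec ⟨hTj, hvt⟩ ⟨hjb, hvb⟩
      have hrank := hT.lt_iff.1 hvt
      refine (wp_search (ℓ := ℓ) (s := s) (j := j) (K := rank (val σ) a b j - i) (m := E.reg .m)
        hW hn hs hN (by simp [hrn]) (by simp [hrj]) (by omega) (by omega) (by simp)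
        (by simp) h.m_le (by omega) ?_).frame.mono ?_
      · intro k hk0 hk
        obtain ⟨hTk, -⟩ := h.isTop k hk (by omega)
        simp only [Env.arr_set, Env.arr_tick]
        refine ⟨by have := hTk.2.1; omega, hTk.lt_iff.trans (by omega)⟩
      · rintro E₁ ⟨⟨h1, h2, h3, h4⟩, hF⟩
        have e1 := hF.reg .p rfl
        have e2 := hF.reg .m rfl
        have e3 := hF.reg .s rfl
        have e4 := hF.reg .i rfl
        have e5 := hF.reg .r rfl
        have e6 := hF.reg .j rfl
        have e7 := fun f => hF.arr f rfl
        simp only [Env.reg_set, Env.arr_set, Env.reg_tick, Env.arr_tick, reduceCtorEq, if_false,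
          hri, hrr, hrj, hrs, Env.time_set, Env.time_tick] at e1 e2 e3 e4 e5 e6 e7 h4
        have hinv : Passing (val σ) a b i s r j E₁ := by
          simp only [Passing, e1, e2, e7]
          exact h
        -- If the search stopped at the last existing pile `m < s`, a rank above `i + m + 1` would
        -- require an earlier position of rank `i + m + 1`, but that pile is still empty.
        have hup : E₁.reg .lo < s → rank (val σ) a b j ≤ i + E₁.reg .lo + 1 := by
          intro hlt
          rcases h1.lt_or_eq with hlt' | heq
          · have := h3 hlt'
            omega
          · by_contra hcon
            obtain ⟨x, g1, g2, g3⟩ := exists_of_lt_rank (not_le.1 hcon)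
            exact h.ne (E₁.reg .lo + 1) (by omega) (by omega) x g2.1 g1 g3
        simp only [wp_block_singleton, wp_branch, Cond.holds_lt, wp_skip, e3]
        refine ⟨fun hlt => ?_, fun hlt => ⟨?_, by simp only [Env.time_tick]; omega⟩⟩
        · have := hup hlt
          refine (wp_place (E := E₁.tick) (ℓ := ℓ) hW hn hN hab hb e4 e5 e6 hinv hg hcap
            (by simp only [Env.reg_tick]; omega) hlt (h1.trans e2.ge)
            (by simp only [Env.reg_tick]; omega)).mono ?_
          rintro E₂ ⟨g1, g2⟩
          refine ⟨g1, ?_⟩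
          simp only [Env.time_tick] at g2
          omega
        · exact hinv.skip hrs' fun _ => Or.inr (by omega)
    · refine h.skip hrs' fun hg => Or.inl ?_
      have : ¬ i < rank (val σ) a b j := by
        intro hcon
        simp [hT.lt_iff.2 hcon] at hz'
      have : rank (val σ) a b j ≠ i := fun heq => hbj ⟨hg, heq⟩
      omega
  · refine h.skip hrs' fun hg => ?_
    have := (hg.prec hab).2
    simp [this] at hz
  · refine h.skip hrs' fun hg => Or.inl ?_
    by_contra hcon
    rcases (not_lt.1 hcon).lt_or_eq with hlt | heq
    · obtain ⟨x, g1, g2, g3⟩ := exists_of_lt_rank hlt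
      have := count_pos_iff.2 ⟨x, g2.1, g1, g3⟩
      omega
    · exact hbj ⟨hg, heq.symm⟩

theorem wp_pass {a b i s r ℓ : ℕ} (hW : 100 * (n + 1) < 2 ^ W) (hn : n < 2 ^ ℓ)
    (hs : s ≤ n) (hN : N = 4 * s + 4) (hab : Prec (val σ) a b) (hb : b ≤ n + 1)
    (hrn : E.reg .n = n) (hrs : E.reg .s = s) (hra : E.reg .a = a) (hrb : E.reg .b = b)
    (hri : E.reg .i = i) (hrr : E.reg .r = r) (hrs' : r ≤ s)
    (hbase : BaseInv (val σ) a b i s (E.arr .base) (E.arr .baseAnc))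
    (hcap : 0 < r → count (val σ) a b (i + r) b ≤ 2 * s + 1) :
    wp σ N W pass (fun E' => Passing (val σ) a b i s r b E' ∧
      E'.time ≤ E.time + (23 * ℓ + 103) * (b - a) + 4) E := by
  simp only [pass, wp_block_cons, wp_block_singleton, wp_const, wp_copy]
  have hab' := hab.1
  refine ⟨by omega, by omega, ?_⟩
  refine wp_loop (fun k E' => ∃ j, j + k = b ∧ E'.reg .j = j ∧ Passing (val σ) a b i s r j E' ∧
    E'.time + (23 * ℓ + 103) * k ≤ E.time + (23 * ℓ + 103) * (b - a) + 3) (b - a) ?_ ?_ ?_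
  · refine ⟨a, by omega, by simp [hra], ?_, by simp; omega⟩
    have hno : ∀ x < a, ¬ Good (val σ) a b x := fun x hx hg => absurd hg.le (by omega)
    simp only [Passing, Env.reg_set, Env.arr_set, reduceCtorEq, if_false, if_true]
    exact ⟨count_left.symm, by omega, fun k hk h0 => absurd (h0 (by omega)) (by omega),
      fun k hk hk' => by omega, fun k _ _ x hx hg => absurd hg (hno x hx),
      fun _ x hx hg => absurd hg (hno x hx)⟩
  · rintro k E' hF ⟨j, h1, h2, h3, h4⟩ hlt
    have e1 := hF.reg .n rfl
    have e2 := hF.reg .s rfl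
    have e3 := hF.reg .b rfl
    have e4 := hF.reg .i rfl
    have e5 := hF.reg .r rfl
    have e6 := hF.arr .base rfl
    have e7 := hF.arr .baseAnc rfl
    simp only [Env.reg_set, Env.arr_set, reduceCtorEq, if_false, hrn, hrs, hrb, hri, hrr]
      at e1 e2 e3 e4 e5 e6 e7
    simp only [Cond.holds_lt, h2, e3] at hlt
    obtain ⟨k, rfl⟩ : ∃ k', k = k' + 1 := ⟨k - 1, by omega⟩
    rw [wp_block_cons]
    refine (wp_passStep (E := E'.tick) (ℓ := ℓ) hW hn hs hN hab hb e1 e2 e3 e4 e5 h2 h3 hrs'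
      (by simp only [Env.arr_tick, e6, e7]; exact hbase) hcap hlt).frame.mono ?_
    rintro E₁ ⟨⟨g1, g2⟩, hF1⟩
    have hj := hF1.reg .j rfl
    simp only [Env.reg_tick, h2, Env.time_tick] at hj g2
    simp only [wp_block_singleton, wp_arithConst, Op.eval, Env.reg_set, if_true, hj, Env.time_set]
    refine ⟨by omega, by omega, k, by omega, j + 1, by omega, rfl, g1, ?_⟩
    rw [mul_add] at h4
    omega
  · rintro k E' hF ⟨j, h1, h2, h3, h4⟩ hlt
    have e3 := hF.reg .b rfl
    simp only [Env.reg_set, reduceCtorEq, if_false, hrb] at e3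
    simp only [Cond.holds_lt, h2, e3] at hlt
    obtain rfl : j = b := by omega
    refine ⟨h3, ?_⟩
    simp only [Env.time_tick]
    omega

end RAM

/-! ### Splitting a longest increasing subsequence between two positions -/

namespace RAM

open LIS

variable {n : ℕ} {σ : Fin n → ℤ} {N W : ℕ} {E : Env n} {Q : Env n → Prop}

/-- Choosing the last pile `r` with at most `hi` elements. -/
def selectPile : Cmd :=
  .loop (.lt .hi .x) (.block [.arithConst .sub .r .r 1, .load .x .cnt .r])

/-- Making the recorded pile, which has `q` elements, the base pile. -/
def copyPile : Cmd := .loop (.lt .x .q) (.block [.load .y .buf .x, .store .base .x .y,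
  .load .y .bufAnc .x, .store .baseAnc .x .y, .arithConst .add .x .x 1])

/-- Replacing the base pile by a small pile among the next `s` piles. -/
def advance : Cmd := .block [.copy .r .s, .load .x .cnt .r, .arith .add .hi .s .s,
  .arithConst .add .hi .hi 1, selectPile, pass, .arith .add .i .i .r, .load .q .cnt .r,
  .const .x 0, copyPile, .store .base .x .b]

/-- Processing the next `s` piles. -/
def batch : Cmd := .block [.const .r 0, pass,
  .branch (.lt .m .s) (.block [.load .res .anc .m, .const .go 0]) advance]

/-- Computing a position `res` that splits a longest increasing subsequence between `a` and `b`. -/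
def findPivot : Cmd := .block [.const .i 0, .const .x 0, .store .base .x .a, .const .y 0,
  .store .baseAnc .x .y, .const .x 1, .store .base .x .b, .const .go 1, .loop (.pos .go) batch]

section math

variable {α : Type*} [LinearOrder α] {v : ℕ → α} {a b i s p m r : ℕ}
  {top anc cnt buf bufAnc base baseAnc : ℕ → ℕ}

theorem count_zero_eq_one {j : ℕ} (h : a < j) : count v a b 0 j = 1 := by
  classical
  rw [count, Finset.card_eq_one]
  refine ⟨a, Finset.ext fun x => ?_⟩
  simp only [Finset.mem_filter, Finset.mem_range, Finset.mem_singleton]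
  constructor
  · rintro ⟨-, h1, h2⟩
    exact h1.eq_left h2
  · rintro rfl
    exact ⟨h, Or.inl rfl, rank_left⟩

/-- The first base pile is pile `0`, whose only element is `a`. -/
theorem baseInv_zero (h : a < b) (h0 : base 0 = a) (h1 : base 1 = b) (h2 : baseAnc 0 = 0) :
    BaseInv v a b 0 s base baseAnc where
  elem x hx hr := by
    obtain rfl := hx.eq_left hr
    rw [count_left]
    exact ⟨h0, Or.inl ⟨rfl, h2⟩⟩
  last := by rw [count_zero_eq_one h, h1]
  pos := by rw [count_zero_eq_one h]; omega
  le := by rw [count_zero_eq_one h]; omega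

theorem BaseInv.rank_add_lt (h : BaseInv v a b i s base baseAnc) : i + a < b := by
  obtain ⟨x, h1, h2, h3⟩ := count_pos_iff.1 h.pos
  have := h2.rank_add_le
  omega

/-- An empty pile `m + 1` in the window excludes all ranks above `i + m`, since ranks are attained
without gaps. Hence the top of pile `m` has maximal rank. -/
theorem PassInv.splits (h : PassInv v a b i s r b p m top anc cnt buf bufAnc)
    (hbase : BaseInv v a b i s base baseAnc) (hab : Prec v a b) (hm : m < s) :
    Splits v a b (anc m) := by
  obtain ⟨h1, h2⟩ := h.isTop m le_rfl (fun _ => h.p_eq ▸ hbase.pos)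
  refine h2.splits hab h1.1 fun x hx => ?_
  rw [h1.2.2.1]
  by_contra! hcon
  have hxb := (hx.prec hab).1
  rcases (Nat.succ_le_of_lt hcon).lt_or_eq with hlt | heq
  · obtain ⟨y, g1, g2, g3⟩ := exists_of_lt_rank hlt
    exact h.ne (m + 1) (by omega) (by omega) y (g2.1.trans hxb) g1 g3
  · exact h.ne (m + 1) (by omega) (by omega) x hxb hx heq.symm

theorem PassInv.le_of_count_pos (h : PassInv v a b i s r b p m top anc cnt buf bufAnc)
    {k : ℕ} (hk : k ≤ s) (hc : 0 < count v a b (i + k) b) : k ≤ m := by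
  by_contra! hcon
  obtain ⟨x, g1, g2, g3⟩ := count_pos_iff.1 hc
  exact h.ne k hcon hk x g1 g2 g3

theorem PassInv.baseInv (h : PassInv v a b i s r b p m top anc cnt buf bufAnc)
    (hab : Prec v a b) (hr : 0 < r) (hc : 0 < count v a b (i + r) b)
    (hle : count v a b (i + r) b ≤ 2 * s + 1)
    (h1 : ∀ k < count v a b (i + r) b, base k = buf k ∧ baseAnc k = bufAnc k)
    (h2 : base (count v a b (i + r) b) = b) : BaseInv v a b (i + r) s base baseAnc where
  elem x hx hxr := by
    have hxb := (hx.prec hab).1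
    obtain ⟨e1, e2⟩ := h1 _ (count_lt hx hxr hxb)
    rw [e1, e2]
    exact h.recorded hr x hxb hx hxr
  last := h2
  pos := hc
  le := hle

end math

/-- The scan goes down from `s` and cannot pass `r₀`, whose pile is small enough; so the chosen pile
is also in the upper half. -/
theorem wp_selectPile {s r₀ : ℕ} (hW : 100 * (n + 1) < 2 ^ W) (hs : s ≤ n) (hN : N = 4 * s + 4)
    (hr : E.reg .r = s) (hr₀ : r₀ ≤ s) (hx : E.reg .x = E.arr .cnt s)
    (h : E.arr .cnt r₀ ≤ E.reg .hi) :
    wp σ N W selectPile (fun E' => r₀ ≤ E'.reg .r ∧ E'.reg .r ≤ s ∧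
      E.arr .cnt (E'.reg .r) ≤ E.reg .hi ∧ E'.time ≤ E.time + 8 * s + 1) E := by
  refine wp_loop (fun k E' => E'.reg .r = k ∧ r₀ ≤ k ∧ k ≤ s ∧ E'.reg .x = E.arr .cnt k ∧
    E'.time + 8 * k ≤ E.time + 8 * s) s ⟨hr, hr₀, le_rfl, hx, le_rfl⟩ ?_ ?_
  · rintro k E' hF ⟨h1, h2, h3, h4, h5⟩ hb
    have e1 := hF.reg .hi rfl
    have e2 := hF.arr .cnt rfl
    simp only [Cond.holds_lt, e1, h4] at hb
    have : r₀ ≠ k := by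
      rintro rfl
      omega
    simp only [wp_block_cons, wp_block_singleton, wp_arithConst, wp_load, Op.eval, Env.reg_tick,
      Env.reg_set, Env.arr_set, Env.arr_tick, Env.time_set, Env.time_tick, reduceCtorEq, if_false,
      if_true, h1, e2]
    exact ⟨by omega, by omega, by omega, k - 1, by omega, rfl, by omega, by omega, rfl, by omega⟩
  · rintro k E' hF ⟨h1, h2, h3, h4, h5⟩ hb
    have e1 := hF.reg .hi rfl
    simp only [Cond.holds_lt, e1, h4] at hb
    simp only [Env.reg_tick, Env.time_tick, h1]
    exact ⟨h2, h3, by omega, by omega⟩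

/-- A separate buffer is needed because the old base pile is still read during the pass that records
the new one. -/
theorem wp_copyPile {s q : ℕ} (hW : 100 * (n + 1) < 2 ^ W) (hs : s ≤ n) (hN : N = 4 * s + 4)
    (hq : E.reg .q = q) (hqs : q ≤ 2 * s + 1) (hx : E.reg .x = 0) :
    wp σ N W copyPile (fun E' => E'.reg .x = q ∧
      (∀ k < q, E'.arr .base k = E.arr .buf k ∧ E'.arr .baseAnc k = E.arr .bufAnc k) ∧
      E'.time ≤ E.time + 23 * q + 1) E := by
  refine wp_loop (fun k E' => ∃ x, x + k = q ∧ E'.reg .x = x ∧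
    (∀ k < x, E'.arr .base k = E.arr .buf k ∧ E'.arr .baseAnc k = E.arr .bufAnc k) ∧
    E'.time + 23 * k ≤ E.time + 23 * q) q
    ⟨0, by omega, hx, fun k hk => by omega, by omega⟩ ?_ ?_
  · rintro k E' hF ⟨x, h1, h2, h3, h4⟩ hb
    have e1 := hF.reg .q rfl
    have e2 := hF.arr .buf rfl
    have e3 := hF.arr .bufAnc rfl
    simp only [Cond.holds_lt, e1, h2, hq] at hb
    simp only [wp_block_cons, wp_block_singleton, wp_arithConst, wp_load, wp_store, Op.eval,
      Env.reg_tick, Env.reg_set, Env.arr_set, Env.arr_tick, Env.reg_put, Env.arr_put,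
      Env.time_set, Env.time_put, Env.time_tick, reduceCtorEq, if_false, if_true, h2, e2, e3]
    refine ⟨by omega, by omega, by omega, by omega, by omega, by omega, k - 1, by omega, x + 1,
      by omega, rfl, fun k' hk' => ?_, by omega⟩
    by_cases hkx : k' = x
    · subst hkx
      simp
    · rw [Function.update_of_ne hkx, Function.update_of_ne hkx]
      exact h3 k' (by omega)
  · rintro k E' hF ⟨x, h1, h2, h3, h4⟩ hb
    have e1 := hF.reg .q rfl
    simp only [Cond.holds_lt, e1, h2, hq] at hb
    obtain rfl : x = q := by omega
    simp only [Env.reg_tick, Env.arr_tick, Env.time_tick]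
    exact ⟨h2, h3, by omega⟩

/-- The registers and parameters during the computation of a pivot. -/
structure Setting (σ : Fin n → ℤ) (N W ℓ s a b : ℕ) (E : Env n) : Prop where
  word : 100 * (n + 1) < 2 ^ W
  size : n < 2 ^ ℓ
  pos : 0 < ℓ
  one_lt : 1 < s
  le : s ≤ n
  le_sq : n ≤ s * s
  len : N = 4 * s + 4
  prec : Prec (val σ) a b
  le_last : b ≤ n + 1
  n_eq : E.reg .n = n
  s_eq : E.reg .s = s
  a_eq : E.reg .a = a
  b_eq : E.reg .b = b

variable {ℓ s a b : ℕ}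

theorem Setting.congr (h : Setting σ N W ℓ s a b E) {E' : Env n} (hn : E'.reg .n = E.reg .n)
    (hs : E'.reg .s = E.reg .s) (ha : E'.reg .a = E.reg .a) (hb : E'.reg .b = E.reg .b) :
    Setting σ N W ℓ s a b E' :=
  { h with n_eq := hn.trans h.n_eq, s_eq := hs.trans h.s_eq, a_eq := ha.trans h.a_eq,
           b_eq := hb.trans h.b_eq }

theorem Setting.one_le (h : Setting σ N W ℓ s a b E) : b - a ≤ ℓ * (b - a) ∧ 0 < b - a := by
  have := h.prec.1
  exact ⟨Nat.le_mul_of_pos_left _ h.pos, by omega⟩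

theorem Setting.wp_pass (h : Setting σ N W ℓ s a b E) {i r : ℕ}
    (hri : E.reg .i = i) (hrr : E.reg .r = r) (hrs : r ≤ s)
    (hbase : BaseInv (val σ) a b i s (E.arr .base) (E.arr .baseAnc))
    (hcap : 0 < r → count (val σ) a b (i + r) b ≤ 2 * s + 1) :
    wp σ N W pass (fun E' => Passing (val σ) a b i s r b E' ∧
      E'.time ≤ E.time + 130 * (ℓ * (b - a))) E := by
  refine (RAM.wp_pass (ℓ := ℓ) h.word h.size h.le h.len h.prec h.le_last h.n_eq h.s_eq h.a_eq
    h.b_eq hri hrr hrs hbase hcap).mono fun E' h' => ⟨h'.1, h'.2.trans ?_⟩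
  obtain ⟨h1, h2⟩ := h.one_le
  rw [add_mul, mul_assoc]
  omega

/-- The preceding pass has supplied the sizes of all `s` piles, so a second pass can record the
selected one. -/
theorem wp_advance (h : Setting σ N W ℓ s a b E) {i : ℕ} (hri : E.reg .i = i)
    (hbase : BaseInv (val σ) a b i s (E.arr .base) (E.arr .baseAnc))
    (hpass : Passing (val σ) a b i s 0 b E) (hm : s ≤ E.reg .m) :
    wp σ N W advance (fun E' => s + 2 * i < 2 * E'.reg .i ∧
      BaseInv (val σ) a b (E'.reg .i) s (E'.arr .base) (E'.arr .baseAnc) ∧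
      E'.time ≤ E.time + 200 * (ℓ * (b - a))) E := by
  have hW := h.word
  have hs1 := h.one_lt
  have hsn := h.le
  have hN := h.len
  have hb := h.le_last
  have hpos : ∀ k, 0 < k → k ≤ s →
      E.arr .cnt k = count (val σ) a b (i + k) b ∧ 0 < count (val σ) a b (i + k) b := by
    intro k hk0 hk
    have hT := (hpass.isTop k (by omega) (by omega)).1
    exact ⟨hpass.cnt_eq k hk0 (by omega), count_pos_iff.2 ⟨_, hT.2.1, hT.1, hT.2.2.1⟩⟩
  -- Since pile `s` is nonempty, `s < b - a`; the scan over pile sizes is thus absorbed into the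
  -- cost of a pass.
  have hsb : i + s + a < b := by
    have hT := (hpass.isTop s (by omega) (by omega)).1
    have h1 := hT.1.rank_add_le
    have h2 := hT.2.1
    rw [hT.2.2.1] at h1
    omega
  obtain ⟨r₀, g1, g2, g3⟩ := exists_small_count (v := val σ) (a := a) (b := b) (i := i) (s := s)
    hs1 (by have := h.le_sq; omega)
  obtain ⟨hD1, hD2⟩ := h.one_le
  simp only [advance, wp_block_cons, wp_copy, wp_load, wp_arith, wp_arithConst, Op.eval,
    Env.reg_set, Env.arr_set, reduceCtorEq, if_false, if_true, h.s_eq]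
  refine ⟨by omega, by omega, by omega, by omega, ?_⟩
  refine (wp_selectPile (s := s) (r₀ := r₀) hW hsn hN (by simp) g2 (by simp) ?_).frame.mono ?_
  · simp only [Env.reg_set, Env.arr_set, if_true]
    rw [(hpos r₀ (by omega) g2).1]
    omega
  rintro E₁ ⟨⟨h1, h2, h3, ht1⟩, hF1⟩
  have en := hF1.reg .n rfl
  have es := hF1.reg .s rfl
  have ea := hF1.reg .a rfl
  have eb := hF1.reg .b rfl
  have ei := hF1.reg .i rfl
  have earr := fun f => hF1.arr f rfl
  simp only [Env.reg_set, Env.arr_set, Env.time_set, reduceCtorEq, if_false, if_true, hri]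
    at en es ea eb ei earr h3 ht1
  obtain ⟨c1, c2⟩ := hpos _ (by omega) h2
  rw [c1] at h3
  have h' := h.congr en es ea eb
  refine wp_block_cons.2 ((h'.wp_pass ei rfl h2 (by rw [earr, earr]; exact hbase)
    (fun _ => by omega)).frame.mono ?_)
  rintro E₂ ⟨⟨hP, ht2⟩, hF2⟩
  have e2i := hF2.reg .i rfl
  have e2r := hF2.reg .r rfl
  have e2b := hF2.reg .b rfl
  have hrm := hP.le_of_count_pos h2 c2
  have hcr := hP.cnt_eq _ (by omega) hrm
  have hcb := count_le (v := val σ) (a := a) (b := b) (k := i + E₁.reg .r) (j := b)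
  simp only [wp_block_cons, wp_load, wp_arith, wp_const, Op.eval, Env.reg_set, Env.arr_set,
    reduceCtorEq, if_false, e2i, e2r, ei, hcr]
  refine ⟨by omega, by omega, by omega, ?_⟩
  refine (wp_copyPile (s := s) (q := count (val σ) a b (i + E₁.reg .r) b) hW hsn hN (by simp)
    (by omega) (by simp)).frame.mono ?_
  rintro E₃ ⟨⟨hx3, hc3, ht3⟩, hF3⟩
  have e3i := hF3.reg .i rfl
  have e3b := hF3.reg .b rfl
  simp only [Env.reg_set, Env.arr_set, Env.time_set, reduceCtorEq, if_false, if_true, e2b, eb,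
    h.b_eq] at e3i e3b hc3 ht3
  simp only [wp_block_singleton, wp_store, Env.reg_put, Env.arr_put, reduceCtorEq, if_false,
    if_true, Env.time_put, e3i, e3b, hx3]
  refine ⟨by omega, by omega, ?_, by omega⟩
  refine hP.baseInv h.prec (by omega) c2 (by omega) (fun k hk => ?_) (by simp)
  rw [Function.update_of_ne (by omega)]
  exact hc3 k hk

theorem wp_batch (h : Setting σ N W ℓ s a b E) {i : ℕ} (hri : E.reg .i = i)
    (hgo : E.reg .go = 1)
    (hbase : BaseInv (val σ) a b i s (E.arr .base) (E.arr .baseAnc)) :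
    wp σ N W batch (fun E' => E'.time ≤ E.time + 340 * (ℓ * (b - a)) ∧
      ((E'.reg .go = 0 ∧ Splits (val σ) a b (E'.reg .res)) ∨ (E'.reg .go = 1 ∧
        s + 2 * i < 2 * E'.reg .i ∧
        BaseInv (val σ) a b (E'.reg .i) s (E'.arr .base) (E'.arr .baseAnc)))) E := by
  have hW := h.word
  have hN := h.len
  have hsn := h.le
  obtain ⟨hD1, hD2⟩ := h.one_le
  simp only [batch, wp_block_cons, wp_const]
  refine ⟨by omega, ?_⟩
  have h' : Setting σ N W ℓ s a b (E.set .r 0 1) := h.congr rfl rfl rfl rfl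
  refine (h'.wp_pass (i := i) (r := 0) (by simp [hri]) (by simp) (by omega) hbase
    (by simp)).frame.mono ?_
  rintro E₁ ⟨⟨hP, ht1⟩, hF1⟩
  have e1 := hF1.reg .i rfl
  have e2 := hF1.reg .go rfl
  have e3 := hF1.arr .base rfl
  have e4 := hF1.arr .baseAnc rfl
  have e5 := hF1.reg .s rfl
  have h₁ := h'.congr (hF1.reg .n rfl) (hF1.reg .s rfl) (hF1.reg .a rfl) (hF1.reg .b rfl)
  simp only [Env.reg_set, Env.arr_set, Env.time_set, reduceCtorEq, if_false, hri, hgo]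
    at e1 e2 e3 e4 ht1
  have hms := hP.m_le
  simp only [wp_block_cons, wp_block_singleton, wp_branch, Cond.holds_lt, wp_load, wp_const,
    h₁.s_eq, Env.reg_tick, Env.arr_tick, Env.reg_set, Env.time_set, Env.time_tick,
    reduceCtorEq, if_false, if_true]
  refine ⟨fun hlt => ⟨by omega, by omega, by omega, Or.inl ⟨trivial, hP.splits hbase h.prec hlt⟩⟩,
    fun hlt => ?_⟩
  have h₂ : Setting σ N W ℓ s a b E₁.tick := h₁.congr rfl rfl rfl rfl
  refine (wp_advance h₂ (i := i) e1 (by simp only [Env.arr_tick, e3, e4]; exact hbase) hP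
    (not_lt.1 hlt)).frame.mono ?_
  rintro E₂ ⟨⟨g1, g2, g3⟩, hF2⟩
  have e6 := hF2.reg .go rfl
  simp only [Env.reg_tick, Env.time_tick, e2] at e6 g3
  exact ⟨by omega, Or.inr ⟨e6, g1, g2⟩⟩

/-- Each advancing batch increases `2 * i` by more than `s`, and `i ≤ n`. Hence `t` advances satisfy
`t * s ≤ 2 * n`, and `X` bounds the number of batches including the final one. -/
theorem wp_findPivot (h : Setting σ N W ℓ s a b E) {X : ℕ}
    (hX : ∀ k, k * s ≤ 2 * n → k + 1 ≤ X) :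
    wp σ N W findPivot (fun E' => Splits (val σ) a b (E'.reg .res) ∧
      E'.time ≤ E.time + 400 * (ℓ * (b - a) * X)) E := by
  have hW := h.word
  have hN := h.len
  have hb := h.le_last
  have hab := h.prec.1
  obtain ⟨hD1, hD2⟩ := h.one_le
  simp only [findPivot, wp_block_cons, wp_const, wp_store, Env.reg_set, Env.reg_put,
    reduceCtorEq, if_false, if_true]
  refine ⟨by omega, by omega, by omega, by omega, by omega, by omega, by omega, by omega, ?_⟩
  rw [wp_block_singleton]
  set D := ℓ * (b - a) with hD
  -- While running, the measure is `n - i + 1`; after the answer is found it is `0`. A batch costs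
  -- `340 * D`, and one more unit pays for the loop test.
  refine wp_loop (fun k E' => (∃ i t, E'.reg .i = i ∧ t * s ≤ 2 * i ∧
      BaseInv (val σ) a b i s (E'.arr .base) (E'.arr .baseAnc) ∧
      E'.reg .go = 1 ∧ k = n - i + 1 ∧ E'.time ≤ E.time + 20 + t * (341 * D)) ∨
      (∃ t, t * s ≤ 2 * n ∧ E'.reg .go = 0 ∧ k = 0 ∧ Splits (val σ) a b (E'.reg .res) ∧
        E'.time ≤ E.time + 20 + (t + 1) * (341 * D))) (n - 0 + 1) ?_ ?_ ?_
  · refine Or.inl ⟨0, 0, by simp, by omega, baseInv_zero hab ?_ ?_ ?_, by simp, rfl, ?_⟩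
    · simp [h.a_eq]
    · simp [h.b_eq]
    · simp
    · simp
  · rintro k E' hF hI hgo
    simp only [Cond.holds_pos] at hgo
    obtain ⟨i, t, h1, h2, h3, h4, rfl, h5⟩ := hI.resolve_right (by rintro ⟨t, -, h0, -⟩; omega)
    have h' : Setting σ N W ℓ s a b E'.tick :=
      h.congr (hF.reg .n rfl) (hF.reg .s rfl) (hF.reg .a rfl) (hF.reg .b rfl)
    refine (wp_batch h' (i := i) h1 h4 h3).frame.mono ?_
    rintro E₁ ⟨⟨g1, g2⟩, hF1⟩
    have hi := h3.rank_add_lt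
    simp only [Env.time_tick, ← hD] at g1
    have hmul := add_mul t 1 (341 * D)
    rcases g2 with ⟨g2, g3⟩ | ⟨g2, g3, g4⟩
    · exact ⟨0, by omega, Or.inr ⟨t, by omega, g2, rfl, g3, by omega⟩⟩
    · have hi' := g4.rank_add_lt
      exact ⟨n - E₁.reg .i + 1, by omega, Or.inl ⟨_, t + 1, rfl, by rw [add_mul]; omega, g4,
        g2, rfl, by omega⟩⟩
  · rintro k E' hF hI hgo
    simp only [Cond.holds_pos] at hgo
    obtain ⟨t, h2, h3, -, h5, h6⟩ := hI.resolve_left (by rintro ⟨i, t, -, -, -, h0, -⟩; omega)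
    have hle := Nat.mul_le_mul_right (341 * D) (hX t h2)
    have hX1 := Nat.mul_le_mul_right D (hX 0 (by omega))
    refine ⟨h5, ?_⟩
    simp only [Env.time_tick]
    have : X * (341 * D) = 341 * (D * X) := by ring
    have : X * D = D * X := by ring
    omega

end RAM

/-! ### Computing a longest increasing subsequence -/

namespace RAM

open LIS

variable {n : ℕ} {σ : Fin n → ℤ} {N W : ℕ} {E : Env n} {Q : Env n → Prop} {ℓ s X : ℕ}

/-- Processing the interval between the last output and the top of the stack. -/
def mainStep : Cmd := .block [.arithConst .sub .x .sp 1, .load .b .stack .x, findPivot,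
  .branch (.pos .res)
    (.block [.store .stack .sp .res, .arithConst .add .sp .sp 1])
    (.block [.copy .a .b, .arithConst .sub .sp .sp 1, .branch (.le .b .n) (.output .b) .skip])]

/-- Computing a longest increasing subsequence. -/
def main : Cmd := .block [.const .a 0, .const .sp 1, .const .x 0, .arithConst .add .b .n 1,
  .store .stack .x .b, .loop (.pos .sp) mainStep]

/-- The output, with positions counted from `1`. -/
def Env.positions (E : Env n) : List ℕ := E.out.map fun i : Fin n => (i : ℕ) + 1

/-- The state of the main loop: the element at position `a` was output last, and `b` is the top of
the stack, above `k` other entries. -/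
structure MainInv (σ : Fin n → ℤ) (N W ℓ s X a b k : ℕ) (E : Env n) : Prop where
  word : 100 * (n + 1) < 2 ^ W
  size : n < 2 ^ ℓ
  pos : 0 < ℓ
  one_lt : 1 < s
  le : s ≤ n
  le_sq : n ≤ s * s
  len : N = 4 * s + 4
  batches : ∀ k, k * s ≤ 2 * n → k + 1 ≤ X
  prec : Prec (val σ) a b
  le_last : b ≤ n + 1
  n_eq : E.reg .n = n
  s_eq : E.reg .s = s
  a_eq : E.reg .a = a
  sp_eq : E.reg .sp = k + 1
  stack_eq : E.arr .stack k = b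
  lt_len : k < N

/-- Stack space is needed only if a pivot is pushed, which cannot happen when the interval contains
no admissible element; hence the alternative in `hk`. -/
theorem wp_mainStep {a b k : ℕ} (h : MainInv σ N W ℓ s X a b k E)
    (hk : k + 1 < N ∨ Longest (val σ) a b []) :
    wp σ N W mainStep (fun E' => E'.reg .n = n ∧ E'.reg .s = s ∧
      E'.time + 2 ≤ E.time + (b - a) * (420 * (ℓ * X)) ∧
      (∀ k' ≤ k, E'.arr .stack k' = E.arr .stack k') ∧
      ((Longest (val σ) a b [] ∧ E'.reg .a = b ∧ E'.reg .sp = k ∧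
        E'.positions = E.positions ++ if b ≤ n then [b] else []) ∨
      ∃ m, m ≠ 0 ∧ Splits (val σ) a b m ∧ E'.reg .a = a ∧ E'.reg .sp = k + 2 ∧
        E'.arr .stack (k + 1) = m ∧ E'.positions = E.positions)) E := by
  have hW := h.word
  have hN := h.len
  have hb := h.le_last
  have hab := h.prec.1
  have hkN := h.lt_len
  have hX := h.batches 0 (by omega)
  have hsn := h.le
  simp only [mainStep, wp_block_cons, wp_load, wp_arithConst, Op.eval, Env.reg_set, Env.arr_set,
    if_true, h.sp_eq, Nat.add_sub_cancel, h.stack_eq]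
  refine ⟨by omega, by omega, hkN, ?_⟩
  refine (wp_findPivot (ℓ := ℓ) (s := s) (a := a) (b := b) ⟨h.word, h.size, h.pos, h.one_lt, h.le,
    h.le_sq, h.len, h.prec, h.le_last, by simp [h.n_eq], by simp [h.s_eq], by simp [h.a_eq],
    by simp⟩ h.batches).frame.mono ?_
  rintro E₁ ⟨⟨hS, ht⟩, hF⟩
  have e1 := hF.reg .n rfl
  have e2 := hF.reg .s rfl
  have e3 := hF.reg .a rfl
  have e4 := hF.reg .b rfl
  have e5 := hF.reg .sp rfl
  have e6 := hF.arr .stack rfl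
  have e7 := hF.out rfl
  simp only [Env.reg_set, Env.arr_set, Env.out_set, Env.time_set, reduceCtorEq, if_false, if_true,
    h.n_eq, h.s_eq, h.a_eq, h.sp_eq] at e1 e2 e3 e4 e5 e6 e7 ht
  have hD : ℓ * (b - a) * X = (b - a) * (ℓ * X) := by ring
  have hD' : (b - a) * (420 * (ℓ * X)) = 420 * ((b - a) * (ℓ * X)) := by ring
  have hD1 : 0 < (b - a) * (ℓ * X) :=
    Nat.mul_pos (by omega) (Nat.mul_pos h.pos (by omega))
  rw [hD] at ht
  rw [hD']
  simp only [wp_block_singleton, wp_branch, Cond.holds_pos]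
  constructor
  · intro hres
    have hk' : k + 1 < N := by
      refine hk.resolve_right fun hL => ?_
      rcases hS with ⟨h0, -⟩ | ⟨-, l₁, l₂, t, -, -, -, h4⟩
      · omega
      · have := hL.2 _ h4.1
        simp at this
    simp only [wp_block_cons, wp_block_singleton, wp_store, wp_arithConst, Op.eval, Env.reg_put,
      Env.arr_put, Env.reg_set, Env.arr_set, Env.time_set, Env.time_put, Env.time_tick,
      Env.reg_tick, Env.arr_tick, Env.positions, Env.out_set, Env.out_put, Env.out_tick,
      reduceCtorEq, if_false, if_true, e1, e2, e3, e5, e6, e7]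
    refine ⟨hk', by omega, by omega, trivial, trivial, by omega, fun k' hk' => ?_,
      Or.inr ⟨_, hres.ne', hS, trivial, trivial, by simp, trivial⟩⟩
    rw [Function.update_of_ne (by omega)]
  · intro hres
    have hL : Longest (val σ) a b [] := by
      rcases hS with ⟨-, h0⟩ | ⟨h0, -⟩
      · exact h0
      · omega
    simp only [wp_block_cons, wp_block_singleton, wp_copy, wp_arithConst, wp_branch, wp_output,
      wp_skip, Cond.holds_le, Op.eval, Env.reg_set, Env.arr_set, Env.time_set, Env.time_tick,
      Env.reg_tick, Env.arr_tick, Env.positions, Env.out_set, Env.out_tick,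
      reduceCtorEq, if_false, if_true, e1, e2, e4, e5, e6, e7]
    refine ⟨by omega, by omega, fun hbn => ⟨by omega, trivial, trivial, by omega,
      fun _ _ => trivial, Or.inl ⟨hL, trivial, by omega, ?_⟩⟩,
      fun hbn => ⟨trivial, trivial, by omega, fun _ _ => trivial,
        Or.inl ⟨hL, trivial, by omega, ?_⟩⟩⟩
    · rw [if_pos hbn]
      simp
      omega
    · rw [if_neg hbn]
      simp

/-- The loop with its stack is treated as a recursive procedure in continuation style: it suffices
to continue from any state in which `b` has been popped and its part of the output appended. The
exponent `d` bounds the recursion depth, hence both the stack growth and the number of levels; on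
each level the interval lengths add up to at most `b - a`. -/
theorem wp_mainLoop (d : ℕ) : ∀ {E : Env n} {a b k : ℕ}, MainInv σ N W ℓ s X a b k E →
    k + d < N → (∀ l, Between (val σ) a b l → l.length < 2 ^ d) →
    (∀ E' : Env n, E'.reg .n = n → E'.reg .s = s → E'.reg .a = b → E'.reg .sp = k →
      (∀ k' < k, E'.arr .stack k' = E.arr .stack k') →
      E'.time ≤ E.time + (d + 1) * ((b - a) * (420 * (ℓ * X))) →
      (∃ l, Longest (val σ) a b l ∧
        E'.positions = E.positions ++ (l ++ if b ≤ n then [b] else [])) →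
      wp σ N W (.loop (.pos .sp) mainStep) Q E') →
    wp σ N W (.loop (.pos .sp) mainStep) Q E := by
  induction d with
  | zero =>
    intro E a b k h hk hlen hQ
    have hL : Longest (val σ) a b [] := by
      refine ⟨between_nil.2 h.prec, fun l hl => ?_⟩
      have := hlen l hl
      simpa using this
    refine wp_loop_true (by simp [h.sp_eq]) ?_
    have h' : MainInv σ N W ℓ s X a b k E.tick := { h with }
    refine (wp_mainStep h' (Or.inr hL)).mono ?_
    rintro E₁ ⟨g1, g2, g3, g4, ⟨-, g6, g7, g8⟩ | ⟨m, hm, hS, -⟩⟩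
    · refine hQ E₁ g1 g2 g6 g7 (fun k' hk' => g4 k' hk'.le) ?_ ⟨[], hL, g8⟩
      simp only [Env.time_tick] at g3
      omega
    · rcases hS with ⟨h0, -⟩ | ⟨-, l₁, l₂, t, -, -, -, h4⟩
      · exact absurd h0 hm
      · have := hL.2 _ h4.1
        simp at this
  | succ d ih =>
    intro E a b k h hk hlen hQ
    refine wp_loop_true (by simp [h.sp_eq]) ?_
    have h' : MainInv σ N W ℓ s X a b k E.tick := { h with }
    refine (wp_mainStep h' (Or.inl (by omega))).mono ?_
    rintro E₁ ⟨g1, g2, g3, g4, ⟨g5, g6, g7, g8⟩ | ⟨m, hm, hS, g6, g7, g8, g9⟩⟩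
    · refine hQ E₁ g1 g2 g6 g7 (fun k' hk' => g4 k' hk'.le) ?_ ⟨[], g5, g8⟩
      simp only [Env.time_tick] at g3
      rw [add_mul _ 1]
      omega
    · obtain ⟨-, l₁, l₂, t, h1, h2, h3, h4⟩ := hS.resolve_left (fun h0 => hm h0.1)
      obtain ⟨hb1, hb2⟩ := between_append.1 h4.1
      obtain ⟨hL1, hL2⟩ := h4.split
      -- The whole chain has length at least `2 ^ t` and below `2 ^ (d + 1)`, so both parts, being
      -- shorter than `2 ^ t`, fit the induction hypothesis for `d`.
      have htd : t ≤ d := by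
        have := (Nat.pow_lt_pow_iff_right (by omega : 1 < 2)).1 (h3.trans_lt (hlen _ h4.1))
        omega
      have hpow : 2 ^ t ≤ 2 ^ d := Nat.pow_le_pow_right (by omega) htd
      have ham := hb1.prec.1
      have hmb := hb2.prec.1
      have hbn := h.le_last
      have inv1 : MainInv σ N W ℓ s X a m (k + 1) E₁ :=
        { h with prec := hb1.prec, le_last := by omega, n_eq := g1, s_eq := g2, a_eq := g6,
                 sp_eq := g7, stack_eq := g8, lt_len := by omega }
      refine ih inv1 (by omega) (fun l hl => by have := hL1.2 l hl; omega) ?_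
      rintro E₂ f1 f2 f3 f4 f5 f6 ⟨l₁', f7, f8⟩
      have inv2 : MainInv σ N W ℓ s X m b k E₂ :=
        { h with prec := hb2.prec, n_eq := f1, s_eq := f2, a_eq := f3, sp_eq := f4,
                 stack_eq := by rw [f5 k (by omega), g4 k le_rfl]; exact h.stack_eq }
      -- After the left half, `m` has been output and popped, so it is the new left endpoint and `b`
      -- is again on top of the stack.
      refine ih inv2 (by omega) (fun l hl => by have := hL2.2 l hl; omega) ?_
      rintro E₃ d1 d2 d3 d4 d5 d6 ⟨l₂', d7, d8⟩
      refine hQ E₃ d1 d2 d3 d4 (fun k' hk' => ?_) ?_ ⟨l₁' ++ m :: l₂', h4.join f7 d7, ?_⟩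
      · rw [d5 k' hk', f5 k' (by omega), g4 k' hk'.le, Env.arr_tick]
      · have hsum : (b - a) * (420 * (ℓ * X)) =
            (m - a) * (420 * (ℓ * X)) + (b - m) * (420 * (ℓ * X)) := by
          rw [← add_mul]
          congr 1
          omega
        simp only [Env.time_tick] at g3
        rw [add_mul (d + 1) 1, one_mul]
        have hsum' := congrArg ((d + 1) * ·) hsum
        simp only [mul_add (d + 1)] at hsum'
        omega
      · rw [d8, f8, g9, if_pos (by omega)]
        simp [Env.positions]

/-! ### The whole program and the final constants -/

/-- The initial state. -/
def initialEnv (n s : ℕ) : Env n where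
  reg x := if x = .n then n else if x = .s then s else 0
  arr _ _ := 0
  out := []
  time := 0

theorem represents_initialState (hn : n < 2 ^ W) (hs : s < 2 ^ W) :
    Represents N W (initialState n s) (initialEnv n s) where
  lt a := by
    simp only [initialState]
    split_ifs <;> omega
  zero := rfl
  reg x := by cases x <;> rfl
  arr f i _ := by
    simp only [initialState, initialEnv]
    rw [if_neg (by omega), if_neg (by omega)]
  out := rfl

theorem wp_main (hW : 100 * (n + 1) < 2 ^ W) (hℓ : n < 2 ^ ℓ) (hℓ0 : 0 < ℓ) (hs1 : 1 < s)
    (hsn : s ≤ n) (hns : n ≤ s * s) (hN : N = 4 * s + 4) (hX : ∀ k, k * s ≤ 2 * n → k + 1 ≤ X)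
    (hℓN : ℓ < N) :
    wp σ N W main (fun E => Longest (val σ) 0 (n + 1) E.positions ∧
      E.time ≤ (ℓ + 1) * ((n + 1) * (420 * (ℓ * X))) + 11) (initialEnv n s) := by
  have hprec : Prec (val σ) 0 (n + 1) := ⟨by omega, val_zero_lt (by omega)⟩
  simp only [main, wp_block_cons, wp_const, wp_arithConst, wp_store, Op.eval, Env.reg_set,
    reduceCtorEq, if_false, if_true]
  refine ⟨by omega, by omega, by omega, by omega, by simp [initialEnv]; omega, by omega, ?_⟩
  rw [wp_block_singleton]
  refine wp_mainLoop ℓ (a := 0) (b := n + 1) (k := 0) (s := s) (ℓ := ℓ) (X := X)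
    ⟨hW, hℓ, hℓ0, hs1, hsn, hns, hN, hX, hprec, le_rfl, by simp [initialEnv],
      by simp [initialEnv], by simp, by simp, by simp [initialEnv], by omega⟩ (by omega) ?_ ?_
  · intro l hl
    obtain ⟨j, hj, hle⟩ := hl.exists_rank (Or.inl rfl)
    have h1 := hj.rank_add_le
    have h2 := (hj.prec hprec).1
    omega
  · rintro E' - - - hsp - ht ⟨l, hl, hout⟩
    refine wp_loop_false (by simp [hsp]) ⟨?_, ?_⟩
    · simp only [Env.positions, Env.out_tick] at hout ⊢
      rw [hout]
      simpa [initialEnv] using hl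
    · simp only [Env.time_put, Env.time_set, initialEnv, Nat.sub_zero] at ht
      simp only [Env.time_tick]
      omega

/-- After the shift by one, the sentinels impose no condition: `⊥` and `⊤` compare correctly with
every input element. -/
theorem between_map_iff {l : List (Fin n)} :
    Between (val σ) 0 (n + 1) (l.map fun i : Fin n => (i : ℕ) + 1) ↔ IsIncreasingSubseq σ l := by
  have hrel : ∀ i j : Fin n, Prec (val σ) (i + 1) (j + 1) ↔ i < j ∧ σ i < σ j := by
    intro i j
    unfold Prec
    rw [val_lt_iff (by omega) (by omega) (by omega) (by omega)]
    simp
  have h0 : ∀ i : ℕ, Prec (val σ) 0 (i + 1) := fun i => ⟨by omega, val_zero_lt (by omega)⟩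
  have h1 : ∀ i : Fin n, Prec (val σ) (i + 1) (n + 1) := fun i =>
    ⟨by omega, val_lt_last (by omega) (by omega)⟩
  unfold Between IsIncreasingSubseq
  rw [List.isChain_iff_pairwise, List.pairwise_cons, List.pairwise_append, List.pairwise_map,
    List.pairwise_map, ← List.pairwise_and_iff]
  simp only [hrel]
  constructor
  · exact fun h => h.2.1
  · refine fun h => ⟨?_, h, by simp, ?_⟩
    · simp only [List.mem_append, List.mem_map, List.mem_singleton]
      rintro _ (⟨i, -, rfl⟩ | rfl)
      exacts [h0 i, h0 n]
    · simp only [List.mem_map, List.mem_singleton]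
      rintro _ ⟨i, -, rfl⟩ _ rfl
      exact h1 i

theorem isLongestIncreasingSubseq_out (h : Longest (val σ) 0 (n + 1) E.positions) :
    IsLongestIncreasingSubseq σ E.out := by
  refine ⟨between_map_iff.1 h.1, fun l' hl' => ?_⟩
  simpa [Env.positions] using h.2 _ (between_map_iff.2 hl')

theorem outputs_main (hW : 100 * (n + 1) < 2 ^ W) (hℓ : n < 2 ^ ℓ) (hℓ0 : 0 < ℓ) (hs1 : 1 < s)
    (hsn : s ≤ n) (hns : n ≤ s * s) (hN : N = 4 * s + 4) (hX : ∀ k, k * s ≤ 2 * n → k + 1 ≤ X)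
    (hℓN : ℓ < N) : ∃ t l, Outputs main.compile σ s (32 + 8 * N) W t l ∧
      IsLongestIncreasingSubseq σ l ∧ t ≤ (ℓ + 1) * ((n + 1) * (420 * (ℓ * X))) + 11 := by
  obtain ⟨E, hrun, hL, ht⟩ := wp_main (σ := σ) hW hℓ hℓ0 hs1 hsn hns hN hX hℓN
  obtain ⟨t, S, h1, h2, h3⟩ := hrun.exec (by omega)
    (represents_initialState (by omega) (by omega))
  refine ⟨t, E.out, ⟨by omega, by omega, by omega, S, h1, h2.out⟩,
    isLongestIncreasingSubseq_out hL, le_trans ?_ ht⟩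
  simpa [initialEnv] using h3

end RAM

theorem mainTheorem2 :
    ∃ (p : RAM.Program) (C : ℝ), ∀ n s : ℕ, 2 ≤ n → √(n : ℝ) ≤ (s : ℝ) → s ≤ n →
      ∃ M W : ℕ,
        (W : ℝ) ≤ C * Real.logb 2 n ∧
        ((M * W : ℕ) : ℝ) ≤ C * ((s : ℝ) * Real.logb 2 n) ∧
        ∀ σ : Fin n → ℤ, ∃ (t : ℕ) (l : List (Fin n)),
          RAM.Outputs p σ s M W t l ∧
          IsLongestIncreasingSubseq σ l ∧
          (t : ℝ) ≤ C * ((n : ℝ) ^ 2 * Real.logb 2 n ^ 2 / (s : ℝ)) := by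
  refine ⟨RAM.main.compile, 20000, fun n s hn hs hsn => ?_⟩
  have hns : n ≤ s * s := by
    have := (Real.sqrt_le_left (Nat.cast_nonneg s)).1 hs
    rw [← sq]
    exact_mod_cast this
  have hs1 : 1 < s := by
    by_contra hcon
    interval_cases s <;> omega
  -- This makes the recursion depth at most about `2 * s`, so the stack fits into an array of length
  -- `4 * s + 4`.
  have hns' : n < 2 ^ (2 * s) := by
    have := Nat.lt_two_pow_self (n := s)
    calc n ≤ s * s := hns
      _ < 2 ^ s * 2 ^ s := Nat.mul_lt_mul'' this this
      _ = 2 ^ (2 * s) := by rw [← pow_add]; congr 1; ring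
  have hℓN : Nat.log 2 n + 1 < 4 * s + 4 := by
    have := Nat.log_lt_of_lt_pow (by omega) hns'
    omega
  have hℓ : n < 2 ^ (Nat.log 2 n + 1) := Nat.lt_pow_succ_log_self (by omega) n
  have hL1 : 1 ≤ Real.logb 2 n := by
    rw [Real.le_logb_iff_rpow_le (by norm_num) (by positivity)]
    simpa using (by exact_mod_cast hn : (2 : ℝ) ≤ n)
  have hLℓ : ((Nat.log 2 n : ℕ) : ℝ) ≤ Real.logb 2 n := by
    exact_mod_cast Real.natLog_le_logb n 2
  set L := Real.logb 2 n
  set ℓ := Nat.log 2 n + 1 with hℓdef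
  have hℓL : (ℓ : ℝ) ≤ 2 * L := by
    rw [hℓdef]
    push_cast
    linarith
  -- The factor `100` covers all addresses and intermediate values; nine extra factors `2 ^ ℓ ≥ 3`
  -- are more than enough for it.
  have hW : 100 * (n + 1) < 2 ^ (10 * ℓ) := by
    have h3 : 3 ≤ 2 ^ ℓ := by omega
    calc 100 * (n + 1) ≤ 100 * 2 ^ ℓ := by omega
      _ < 3 ^ 9 * 2 ^ ℓ := by
        have : 0 < 2 ^ ℓ := by positivity
        norm_num
      _ ≤ (2 ^ ℓ) ^ 9 * 2 ^ ℓ := by gcongr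
      _ = 2 ^ (10 * ℓ) := by rw [← pow_succ, ← pow_mul, mul_comm]
  -- From `k * s ≤ 2 * n` and `s ≤ n` one gets `(k + 1) * s ≤ 3 * n`.
  have hX : ∀ k, k * s ≤ 2 * n → k + 1 ≤ 3 * n / s := fun k hk => by
    rw [Nat.le_div_iff_mul_le (by omega), add_mul]
    omega
  have hsR : (2 : ℝ) ≤ s := by exact_mod_cast hs1
  have hnR : (2 : ℝ) ≤ n := by exact_mod_cast hn
  refine ⟨32 + 8 * (4 * s + 4), 10 * ℓ, ?_, ?_, fun σ => ?_⟩
  · push_cast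
    linarith
  · push_cast
    calc (32 + 8 * (4 * (s : ℝ) + 4)) * (10 * ℓ) ≤ (64 * s) * (10 * (2 * L)) := by
          gcongr
          linarith
      _ = 1280 * (s * L) := by ring
      _ ≤ 20000 * (s * L) := by
          gcongr
          norm_num
  · obtain ⟨t, l, h1, h2, h3⟩ := RAM.outputs_main (σ := σ) hW hℓ (by omega) hs1 hsn hns rfl hX hℓN
    refine ⟨t, l, h1, h2, ?_⟩
    have hXR : ((3 * n / s : ℕ) : ℝ) ≤ 3 * n / s := by
      have := Nat.cast_div_le (α := ℝ) (m := 3 * n) (n := s)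
      exact_mod_cast this
    have h3' : (t : ℝ) ≤ (ℓ + 1) * ((n + 1) * (420 * (ℓ * ((3 * n / s : ℕ) : ℝ)))) + 11 := by
      exact_mod_cast h3
    -- This absorbs the additive constant `11` into the main term.
    have hone : 1 ≤ (n : ℝ) ^ 2 * L ^ 2 / s := by
      rw [one_le_div (by linarith)]
      have hsnR : (s : ℝ) ≤ n := by exact_mod_cast hsn
      have : 1 ≤ L ^ 2 := one_le_pow₀ hL1
      nlinarith
    calc (t : ℝ) ≤ (ℓ + 1) * ((n + 1) * (420 * (ℓ * ((3 * n / s : ℕ) : ℝ)))) + 11 := h3'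
      -- The estimates `ℓ ≤ 2 * L`, `1 ≤ L` and `1 ≤ n` give the factor `3 * 2 * 420 * 2 * 3 =
      -- 15120`.
      _ ≤ (2 * L + L) * ((n + n) * (420 * ((2 * L) * (3 * n / s)))) + 11 := by
          gcongr
          linarith
      _ = 15120 * ((n : ℝ) ^ 2 * L ^ 2 / s) + 11 := by ring
      _ ≤ 20000 * ((n : ℝ) ^ 2 * L ^ 2 / s) := by linarith
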